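/- Let $M$ be a compact (Hausdorff) smooth manifold without boundary of dimension $d\ge 3$, let $r\ge 1$ be an integer, and let $\mathfrak X^r(M)$ be the space of $C^r$ vector fields on $M$ with the $C^r$ topology. A closed orbit of $X\in\mathfrak X^r(M)$ is the image $\gamma$ of a nonconstant periodic integral curve of $X$ (so singularities are excluded), and its period $\Pi_X(\gamma)>0$ is the least positive period of that curve. Then there is a residual subset $\mathcal R_1\subset\mathfrak X^r(M)$ (that is, a set containing the intersection of countably many open dense subsets of $\mathfrak X^r(M)$) such that for every $X\in\mathcal R_1$ and any two distinct closed orbits $\gamma,\gamma'$ of $X$, $$\frac{\Pi_X(\gamma)}{\Pi_X(\gamma')}\in\mathbb R\setminus\mathbb Q.$$ -/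

import Mathlib

open scoped Manifold ContDiff

noncomputable section

/-- The space `𝔛^r(M)` of `C^r` vector fields on a smooth `d`-dimensional boundaryless manifold
`M`: the `C^r` sections of the tangent bundle. -/
abbrev CrVectorField (d r : ℕ) (M : Type*) [TopologicalSpace M]
    [ChartedSpace (EuclideanSpace ℝ (Fin d)) M] [IsManifold (𝓡 d) ∞ M] : Type _ :=
  ContMDiffSection (𝓡 d) (EuclideanSpace ℝ (Fin d)) (r : ℕ∞ω) (TangentSpace (𝓡 d) : M → Type _)

namespace CrVectorField

variable {d r : ℕ} {M : Type*} [TopologicalSpace M]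
  [ChartedSpace (EuclideanSpace ℝ (Fin d)) M] [IsManifold (𝓡 d) ∞ M]

/-- The expression of the vector field `X` in the chart `e`: the push-forward of `X` by `e`,
as a map on `ℝ^d` that is meaningful on the open set `e.target`. -/
def localRep (e : OpenPartialHomeomorph M (EuclideanSpace ℝ (Fin d))) (X : CrVectorField d r M) :
    EuclideanSpace ℝ (Fin d) → EuclideanSpace ℝ (Fin d) :=
  fun y => mfderiv (𝓡 d) (𝓡 d) e (e.symm y) (X (e.symm y))

/-- The usual `C^r` topology: the coarsest topology such that, for every chart `e` of the atlas
and every `k ≤ r`, the map sending `X` to the `k`-th derivative of its expression in the chart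
`e` is continuous for uniform convergence on the compact subsets of `e.target`. -/
instance crTopology : TopologicalSpace (CrVectorField d r M) :=
  ⨅ e ∈ atlas (EuclideanSpace ℝ (Fin d)) M, ⨅ k ∈ Set.Iic r,
    TopologicalSpace.induced
      (fun X : CrVectorField d r M =>
        UniformOnFun.ofFun {K : Set (EuclideanSpace ℝ (Fin d)) | IsCompact K ∧ K ⊆ e.target}
          (iteratedFDeriv ℝ k (localRep e X)))
      inferInstance

/-- `O ⊆ M` is a closed orbit of `X`: the range of a nonconstant periodic integral curve.
(Singularities of `X` are not closed orbits.) -/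
def IsClosedOrbit (X : CrVectorField d r M) (O : Set M) : Prop :=
  ∃ γ : ℝ → M, IsMIntegralCurve γ X ∧ (∃ T : ℝ, 0 < T ∧ Function.Periodic γ T) ∧
    (∃ s t : ℝ, γ s ≠ γ t) ∧ Set.range γ = O

/-- The positive return times of the orbit `O`: the positive periods of the integral curves of `X`
that parametrize `O`. -/
def positivePeriods (X : CrVectorField d r M) (O : Set M) : Set ℝ :=
  {T | 0 < T ∧ ∃ γ : ℝ → M, IsMIntegralCurve γ X ∧ Set.range γ = O ∧ Function.Periodic γ T}

/-- The (prime) period `Π_X(O)` of a closed orbit `O` of `X`. For a closed orbit this infimum is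
a minimum, see `isLeast_period`. -/
def period (X : CrVectorField d r M) (O : Set M) : ℝ :=
  sInf (positivePeriods X O)

/-- The period of a closed orbit is its least positive period. -/
theorem isLeast_period [T2Space M] (hr : 1 ≤ r) {X : CrVectorField d r M} {O : Set M}
    (hO : IsClosedOrbit X O) : IsLeast (positivePeriods X O) (period X O) := by
  obtain ⟨γ, hγ, ⟨T₀, hT₀, hper⟩, ⟨s₀, t₀, hne⟩, rfl⟩ := hO
  have hX : ContMDiff (𝓡 d) ((𝓡 d).prod 𝓘(ℝ, EuclideanSpace ℝ (Fin d))) 1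
      (fun x => (⟨x, X x⟩ : TangentBundle (𝓡 d) M)) :=
    X.contMDiff.of_le (by exact_mod_cast hr)
  have hcont : Continuous γ := continuous_iff_continuousAt.2 fun t => (hγ t).continuousAt
  have key : ∀ T, T ∈ positivePeriods X (Set.range γ) ↔ 0 < T ∧ Function.Periodic γ T := by
    intro T
    constructor
    · rintro ⟨hT, δ, hδ, hrange, hδT⟩
      refine ⟨hT, ?_⟩
      obtain ⟨c, hc⟩ : γ 0 ∈ Set.range δ := hrange ▸ Set.mem_range_self 0
      have h : γ = δ ∘ (· + c) :=
        isMIntegralCurve_Ioo_eq_of_contMDiff_boundaryless (t₀ := 0) hX hγ (hδ.comp_add c)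
          (by simp [hc])
      intro t
      rw [h]
      have := hδT (t + c)
      simpa [add_right_comm] using this
    · rintro ⟨hT, h⟩
      exact ⟨hT, γ, hγ, rfl, h⟩
  let S : AddSubgroup ℝ :=
    { carrier := {T | Function.Periodic γ T}
      zero_mem' := fun t => by simp
      add_mem' := fun ha hb => Function.Periodic.add_period ha hb
      neg_mem' := fun ha => Function.Periodic.neg ha }
  have hnd : ¬ Dense (S : Set ℝ) := by
    intro hd
    have hcl : IsClosed (S : Set ℝ) := by
      have : (S : Set ℝ) = ⋂ t : ℝ, {T | γ (t + T) = γ t} := by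
        ext T; simp [S, Function.Periodic]
      rw [this]
      exact isClosed_iInter fun t =>
        isClosed_eq (hcont.comp (continuous_const.add continuous_id)) continuous_const
    have huniv : (S : Set ℝ) = Set.univ := by rw [← hcl.closure_eq, hd.closure_eq]
    have hmem : s₀ - t₀ ∈ (S : Set ℝ) := huniv ▸ Set.mem_univ _
    have := (hmem : Function.Periodic γ (s₀ - t₀)) t₀
    exact hne (by simpa using this)
  obtain ⟨a, ha⟩ := S.dense_or_cyclic.resolve_left hnd
  have ha0 : a ≠ 0 := by
    rintro rfl
    have : T₀ ∈ S := hper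
    rw [ha, AddSubgroup.mem_closure_singleton] at this
    obtain ⟨n, hn⟩ := this
    rw [smul_zero] at hn
    exact hT₀.ne hn
  have hleast : IsLeast (positivePeriods X (Set.range γ)) |a| := by
    constructor
    · rw [key]
      refine ⟨abs_pos.2 ha0, ?_⟩
      have haS : a ∈ S := ha ▸ AddSubgroup.subset_closure rfl
      have habs : |a| ∈ S := by
        rcases abs_choice a with h | h <;> rw [h]
        · exact haS
        · exact S.neg_mem haS
      exact habs
    · intro T hT
      rw [key] at hT
      have hTS : T ∈ S := hT.2
      rw [ha, AddSubgroup.mem_closure_singleton] at hTS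
      obtain ⟨n, rfl⟩ := hTS
      have hn : n ≠ 0 := by
        rintro rfl
        simp at hT
      have h1 : (1 : ℝ) ≤ |(n : ℝ)| := by exact_mod_cast Int.one_le_abs hn
      calc |a| = 1 * |a| := (one_mul _).symm
        _ ≤ |(n : ℝ)| * |a| := by gcongr
        _ = |n • a| := by rw [zsmul_eq_mul, abs_mul]
        _ = n • a := abs_of_pos hT.1
  have : period X (Set.range γ) = |a| := hleast.csInf_eq
  rw [this]
  exact hleast

end CrVectorField

end

set_option linter.unusedSectionVars false

/-! The proof is a Baire argument over countably many closed sets with empty interior. A closed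
orbit crosses some small box of a chart almost straight, once per period, and the boxes can be taken
from a countable family. For two boxes, a rational `c` and a bound `N`, let `Box.bad` be the set of
fields that vary slowly in both boxes and have one loop through each box, of return times `S` and
`S'` at most `N`, with `S = c * S'` and each loop missing the core of the other box. Two distinct
closed orbits with rational period ratio put `X` in such a set.

`Box.bad` is closed: by Gronwall, curves of converging fields converge along an ultrafilter, and
every clause of `IsLoop` survives the limit.

Its interior is empty by a dimension count. Push `X` by `w` in one core and by `w'` in the other,
which gives `2d` parameters. Each loop sees only its own push. Off its core it follows `X`, so
entrance point and return time determine its exit point by running back from the closing time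
(`norm_sub_le_of_backward`). Entrance and exit points then determine the push
(`norm_sub_le_of_transit`). All bounds are Lipschitz. Entrance points lie in hyperplanes, and the
two times are tied by `S = c * S'`, so `(d-1) + (d-1) + 1` numbers determine `(w, w')`. The bad
parameters thus have Hausdorff dimension at most `2d - 1` and contain no open set. Only Lipschitz
dependence is used, so neither transversality nor hyperbolicity of the orbits is needed. -/

noncomputable section

open Set Filter Topology

/-! ### Global coordinates on the manifold and velocities in them -/

namespace CrVectorField

variable {d r : ℕ} {M : Type*} [TopologicalSpace M]
  [ChartedSpace (EuclideanSpace ℝ (Fin d)) M] [IsManifold (𝓡 d) ∞ M]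
  {κ : Type*} [Fintype κ]

/-- The immersion of a manifold into a power of `ℝ^d × ℝ` given by a finite smooth bump covering. -/
def immersion (f : SmoothBumpCovering κ (𝓡 d) M) (x : M) :
    κ → EuclideanSpace ℝ (Fin d) × ℝ :=
  fun i => (f i x • chartAt (EuclideanSpace ℝ (Fin d)) (f.c i) x, f i x)

/-- The velocity of a vector field as seen through `immersion f`. -/
def vel (f : SmoothBumpCovering κ (𝓡 d) M) (X : CrVectorField d r M) (x : M) :
    κ → EuclideanSpace ℝ (Fin d) × ℝ :=
  mfderiv (𝓡 d) 𝓘(ℝ, κ → EuclideanSpace ℝ (Fin d) × ℝ) (immersion f) x (X x)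

variable (f : SmoothBumpCovering κ (𝓡 d) M)

lemma contMDiff_immersion [T2Space M] :
    ContMDiff (𝓡 d) 𝓘(ℝ, κ → EuclideanSpace ℝ (Fin d) × ℝ) ∞ (immersion f) :=
  contMDiff_pi_space.2 fun i =>
    ((f i).contMDiff_smul contMDiffOn_extChartAt).prodMk_space (f i).contMDiff

lemma continuous_immersion [T2Space M] : Continuous (immersion f) :=
  (contMDiff_immersion f).continuous

/-- At an index where the bump is 1 at `x`, the second component forces it to be 1 at `y` too, and
the first component is then the chart at both points. -/
lemma immersion_injective : Function.Injective (immersion f) := by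
  intro x y h
  have h' := congrFun h (f.ind x (mem_univ x))
  obtain ⟨h₁, h₂⟩ := Prod.mk_inj.1 h'
  rw [f.apply_ind x (mem_univ x)] at h₁ h₂
  rw [← h₂, one_smul, one_smul] at h₁
  exact (chartAt _ (f.c _)).injOn (f.mem_chartAt_ind_source x (mem_univ x))
    (f.mem_chartAt_source_of_eq_one h₂.symm) h₁

lemma immersion_fst_of_eq_one {i : κ} {x : M} (h : f i x = 1) :
    (immersion f x i).1 = chartAt (EuclideanSpace ℝ (Fin d)) (f.c i) x := by
  simp [immersion, h]

lemma vel_fst [T2Space M] (X : CrVectorField d r M) {i : κ} {x : M} (h : f i =ᶠ[𝓝 x] 1) :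
    (vel f X x i).1 =
      mfderiv (𝓡 d) (𝓡 d) (chartAt (EuclideanSpace ℝ (Fin d)) (f.c i)) x (X x) := by
  have hx : f i x = 1 := h.self_of_nhds
  set P : (κ → EuclideanSpace ℝ (Fin d) × ℝ) →L[ℝ] EuclideanSpace ℝ (Fin d) :=
    (ContinuousLinearMap.fst ℝ _ ℝ).comp (ContinuousLinearMap.proj i)
  have h1 := P.hasMFDerivAt.comp x
    ((contMDiff_immersion f).mdifferentiableAt (x := x) (by simp)).hasMFDerivAt
  have h2 : P ∘ immersion f =ᶠ[𝓝 x] chartAt (EuclideanSpace ℝ (Fin d)) (f.c i) := by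
    filter_upwards [h] with y hy
    exact immersion_fst_of_eq_one f hy
  have h3 := h1.congr_of_eventuallyEq h2.symm
  have h4 := h3.mfderiv
  rw [h4]
  rfl

lemma vel_add (X Y : CrVectorField d r M) (x : M) : vel f (X + Y) x = vel f X x + vel f Y x :=
  (mfderiv (𝓡 d) 𝓘(ℝ, κ → EuclideanSpace ℝ (Fin d) × ℝ) (immersion f) x).map_add (X x) (Y x)

lemma vel_of_eq_zero (X : CrVectorField d r M) {x : M} (h : X x = 0) : vel f X x = 0 := by
  simp only [vel, h]
  exact (mfderiv (𝓡 d) 𝓘(ℝ, κ → EuclideanSpace ℝ (Fin d) × ℝ) (immersion f) x).map_zero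

lemma contMDiff_vel [T2Space M] (X : CrVectorField d r M) :
    ContMDiff (𝓡 d) 𝓘(ℝ, κ → EuclideanSpace ℝ (Fin d) × ℝ) r (vel f X) := by
  have h1 : ContMDiff (𝓡 d).tangent 𝓘(ℝ, κ → EuclideanSpace ℝ (Fin d) × ℝ).tangent r
      (tangentMap (𝓡 d) 𝓘(ℝ, κ → EuclideanSpace ℝ (Fin d) × ℝ) (immersion f)) :=
    (contMDiff_immersion f).contMDiff_tangentMap (by norm_cast; exact le_top)
  have h2 := h1.comp X.contMDiff
  exact (contMDiff_snd_tangentBundle_modelSpace _ 𝓘(ℝ, κ → EuclideanSpace ℝ (Fin d) × ℝ)).comp h2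

lemma localRep_add (e : OpenPartialHomeomorph M (EuclideanSpace ℝ (Fin d)))
    (X Y : CrVectorField d r M) : localRep e (X + Y) = localRep e X + localRep e Y :=
  funext fun _ => map_add (mfderiv (𝓡 d) (𝓡 d) e _) _ _

lemma localRep_smul (e : OpenPartialHomeomorph M (EuclideanSpace ℝ (Fin d))) (c : ℝ)
    (X : CrVectorField d r M) : localRep e (c • X) = c • localRep e X :=
  funext fun y => (mfderiv (𝓡 d) (𝓡 d) e (e.symm y)).map_smul c (X (e.symm y))

lemma contDiffOn_localRep {e : OpenPartialHomeomorph M (EuclideanSpace ℝ (Fin d))}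
    (he : e ∈ atlas (EuclideanSpace ℝ (Fin d)) M) (X : CrVectorField d r M) :
    ContDiffOn ℝ r (localRep e X) e.target := by
  have hem := IsManifold.subset_maximalAtlas (I := 𝓡 d) (n := ∞) he
  have h1 : ContMDiffOn (𝓡 d).tangent (𝓡 d).tangent r
      (tangentMapWithin (𝓡 d) (𝓡 d) e e.source) (Bundle.TotalSpace.proj ⁻¹' e.source) :=
    (contMDiffOn_of_mem_maximalAtlas hem).contMDiffOn_tangentMapWithin
      (by norm_cast; exact le_top) e.open_source.uniqueMDiffOn
  have h2 : ContMDiffOn (𝓡 d) (𝓡 d) r e.symm e.target :=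
    (contMDiffOn_symm_of_mem_maximalAtlas hem).of_le (by exact_mod_cast le_top)
  have h3 := h1.comp (X.contMDiff.comp_contMDiffOn h2) (fun y hy => e.map_target hy)
  have h4 := (contMDiff_snd_tangentBundle_modelSpace _ (𝓡 d) (n := r)).comp_contMDiffOn h3
  refine (contMDiffOn_iff_contDiffOn.1 h4).congr fun y hy => ?_
  exact (DFunLike.congr_fun (mfderivWithin_of_isOpen (I := 𝓡 d) (I' := 𝓡 d) (f := e)
    e.open_source (e.map_target hy)) (X (e.symm y))).symm

/-- This links the velocity in the ambient space to `localRep`, the quantity that the topology on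
vector fields controls. -/
lemma vel_symm [T2Space M] (X : CrVectorField d r M) (i : κ) {y : EuclideanSpace ℝ (Fin d)}
    (hy : y ∈ (chartAt (EuclideanSpace ℝ (Fin d)) (f.c i)).target) :
    vel f X ((chartAt (EuclideanSpace ℝ (Fin d)) (f.c i)).symm y) =
      fderiv ℝ (immersion f ∘ (chartAt (EuclideanSpace ℝ (Fin d)) (f.c i)).symm) y
        (localRep (chartAt (EuclideanSpace ℝ (Fin d)) (f.c i)) X y) := by
  set e := chartAt (EuclideanSpace ℝ (Fin d)) (f.c i) with he
  have hem := IsManifold.subset_maximalAtlas (I := 𝓡 d) (n := ∞) (chart_mem_atlas _ (f.c i))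
  have hx := e.map_target hy
  have h2 : MDifferentiableAt (𝓡 d) (𝓡 d) e.symm y :=
    ((contMDiffOn_symm_of_mem_maximalAtlas hem).contMDiffAt
      (e.open_target.mem_nhds hy)).mdifferentiableAt (by simp)
  have h1 : MDifferentiableAt (𝓡 d) (𝓡 d) e (e.symm y) :=
    ((contMDiffOn_of_mem_maximalAtlas hem).contMDiffAt
      (e.open_source.mem_nhds hx)).mdifferentiableAt (by simp)
  have h3 : MDifferentiableAt (𝓡 d) 𝓘(ℝ, κ → EuclideanSpace ℝ (Fin d) × ℝ) (immersion f)
      (e.symm y) :=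
    (contMDiff_immersion f).mdifferentiableAt (by simp)
  have h4 : MDifferentiableAt (𝓡 d) 𝓘(ℝ, κ → EuclideanSpace ℝ (Fin d) × ℝ)
      (immersion f ∘ e.symm) (e (e.symm y)) := by
    rw [e.right_inv hy]; exact h3.comp y h2
  have h5 := h4.hasMFDerivAt.comp (e.symm y) h1.hasMFDerivAt
  have h6 : immersion f =ᶠ[𝓝 (e.symm y)] (immersion f ∘ e.symm) ∘ e := by
    filter_upwards [e.open_source.mem_nhds hx] with z hz
    simp [e.left_inv hz]
  have h7 := (h5.congr_of_eventuallyEq h6).mfderiv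
  rw [vel, h7]
  simp only [e.right_inv hy, mfderiv_eq_fderiv]
  rfl

end CrVectorField

/-! ### The `C^r` topology: finite-dimensional families and uniform convergence -/

namespace CrVectorField

variable {d r : ℕ} {M : Type*} [TopologicalSpace M]
  [ChartedSpace (EuclideanSpace ℝ (Fin d)) M] [IsManifold (𝓡 d) ∞ M]
  {κ : Type*} [Fintype κ]

lemma tendsto_iff {α : Type*} {l : Filter α} {Y : α → CrVectorField d r M}
    {X : CrVectorField d r M} :
    Tendsto Y l (𝓝 X) ↔ ∀ e ∈ atlas (EuclideanSpace ℝ (Fin d)) M, ∀ k ≤ r,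
      ∀ K : Set (EuclideanSpace ℝ (Fin d)), IsCompact K → K ⊆ e.target →
        TendstoUniformlyOn (fun a => iteratedFDeriv ℝ k (localRep e (Y a)))
          (iteratedFDeriv ℝ k (localRep e X)) l K := by
  simp only [nhds_iInf, tendsto_iInf, nhds_induced, tendsto_comap_iff, mem_Iic,
    UniformOnFun.tendsto_iff_tendstoUniformlyOn, mem_ofPred_eq, and_imp]
  rfl

lemma contDiffAt_localRep {e : OpenPartialHomeomorph M (EuclideanSpace ℝ (Fin d))}
    (he : e ∈ atlas (EuclideanSpace ℝ (Fin d)) M) (X : CrVectorField d r M)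
    {y : EuclideanSpace ℝ (Fin d)} (hy : y ∈ e.target) {k : ℕ} (hk : k ≤ r) :
    ContDiffAt ℝ k (localRep e X) y :=
  ((contDiffOn_localRep he X).contDiffAt (e.open_target.mem_nhds hy)).of_le (by exact_mod_cast hk)

/-- On a compact set the derivatives are linear in `g`, so bounds for the finitely many basis fields
suffice. -/
lemma tendsto_add_linear {G : Type*} [NormedAddCommGroup G] [NormedSpace ℝ G]
    [FiniteDimensional ℝ G] (X : CrVectorField d r M) (L : G →ₗ[ℝ] CrVectorField d r M) :
    Tendsto (fun g => X + L g) (𝓝 0) (𝓝 X) := by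
  rw [tendsto_iff]
  intro e he k hk K hK hKe
  set b := Module.finBasis ℝ G
  have hbd : ∀ j, ∃ C, ∀ y ∈ K, ‖iteratedFDeriv ℝ k (localRep e (L (b j))) y‖ ≤ C := fun j =>
    hK.exists_bound_of_continuousOn fun y hy =>
      ((contDiffAt_localRep he _ (hKe hy) hk).continuousAt_iteratedFDeriv
        le_rfl).continuousWithinAt
  choose C hC using hbd
  have key : ∀ g, ∀ y ∈ K, ‖iteratedFDeriv ℝ k (localRep e (X + L g)) y -
      iteratedFDeriv ℝ k (localRep e X) y‖ ≤ ∑ j, |b.repr g j| * C j := by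
    intro g y hy
    let T : G →ₗ[ℝ] ContinuousMultilinearMap ℝ (fun _ : Fin k => EuclideanSpace ℝ (Fin d))
        (EuclideanSpace ℝ (Fin d)) :=
      { toFun := fun g => iteratedFDeriv ℝ k (localRep e (L g)) y
        map_add' := fun g g' => by
          rw [map_add, localRep_add, iteratedFDeriv_add_apply
            (contDiffAt_localRep he _ (hKe hy) hk) (contDiffAt_localRep he _ (hKe hy) hk)]
        map_smul' := fun c g => by
          rw [map_smul, localRep_smul, iteratedFDeriv_const_smul_apply
            (contDiffAt_localRep he _ (hKe hy) hk)]
          rfl }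
    have h1 : iteratedFDeriv ℝ k (localRep e (X + L g)) y -
        iteratedFDeriv ℝ k (localRep e X) y = T g := by
      rw [localRep_add, iteratedFDeriv_add_apply (contDiffAt_localRep he _ (hKe hy) hk)
        (contDiffAt_localRep he _ (hKe hy) hk), add_sub_cancel_left]
      rfl
    have h2 : T g = ∑ j, b.repr g j • T (b j) := by
      conv_lhs => rw [← b.sum_repr g, map_sum]
      simp only [map_smul]
    rw [h1, h2]
    refine (norm_sum_le _ _).trans (Finset.sum_le_sum fun j _ => ?_)
    rw [norm_smul, Real.norm_eq_abs]
    exact mul_le_mul_of_nonneg_left (hC j y hy) (abs_nonneg _)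
  have hlim : Tendsto (fun g => ∑ j, |b.repr g j| * C j) (𝓝 0) (𝓝 0) := by
    have hc : Continuous fun g => ∑ j, |b.repr g j| * C j :=
      continuous_finsetSum _ fun j _ =>
        ((LinearMap.continuous_of_finiteDimensional (b.coord j)).abs).mul continuous_const
    simpa using hc.tendsto 0
  rw [Metric.tendstoUniformlyOn_iff]
  intro ε hε
  filter_upwards [hlim.eventually (gt_mem_nhds hε)] with g hg y hy
  rw [dist_comm, dist_eq_norm]
  exact (key g y hy).trans_lt hg

variable (f : SmoothBumpCovering κ (𝓡 d) M)

lemma contDiffOn_immersion_symm [T2Space M] (i : κ) :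
    ContDiffOn ℝ ∞ (immersion f ∘ (chartAt (EuclideanSpace ℝ (Fin d)) (f.c i)).symm)
      (chartAt (EuclideanSpace ℝ (Fin d)) (f.c i)).target := by
  have hem := IsManifold.subset_maximalAtlas (I := 𝓡 d) (n := ∞) (chart_mem_atlas _ (f.c i))
  exact contMDiffOn_iff_contDiffOn.1
    ((contMDiff_immersion f).comp_contMDiffOn (contMDiffOn_symm_of_mem_maximalAtlas hem))

lemma isClosed_eq_one [T2Space M] (i : κ) : IsClosed {x | f i x = 1} :=
  isClosed_eq (f i).continuous continuous_const

/-- Order `k = 0` is enough: the compact sets where some bump equals 1 cover `M`, and on each one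
the velocity is a bounded linear image of `localRep`. -/
lemma tendstoUniformly_vel [T2Space M] [CompactSpace M] {α : Type*} {l : Filter α}
    {Y : α → CrVectorField d r M} {X : CrVectorField d r M} (h : Tendsto Y l (𝓝 X)) :
    TendstoUniformly (fun a => vel f (Y a)) (vel f X) l := by
  rw [tendsto_iff] at h
  rw [Metric.tendstoUniformly_iff]
  intro ε hε
  have hi : ∀ i : κ, ∀ᶠ a in l, ∀ x, f i x = 1 → dist (vel f X x) (vel f (Y a) x) < ε := by
    intro i
    set e := chartAt (EuclideanSpace ℝ (Fin d)) (f.c i) with he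
    set K := e '' {x | f i x = 1} with hK
    have hsub : ∀ x, f i x = 1 → x ∈ e.source := fun x hx => f.mem_chartAt_source_of_eq_one hx
    have hKc : IsCompact K := (isClosed_eq_one f i).isCompact.image_of_continuousOn
      (e.continuousOn.mono hsub)
    have hKt : K ⊆ e.target := by
      rintro _ ⟨x, hx, rfl⟩
      exact e.map_source (hsub x hx)
    obtain ⟨C, hC⟩ := hKc.exists_bound_of_continuousOn
      (((contDiffOn_immersion_symm f i).continuousOn_fderiv_of_isOpen e.open_target
        (by simp)).mono hKt)
    have h0 := h e (chart_mem_atlas _ _) 0 (Nat.zero_le _) K hKc hKt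
    rw [Metric.tendstoUniformlyOn_iff] at h0
    filter_upwards [h0 (ε / (|C| + 1)) (by positivity)] with a ha x hx
    have hxK : e x ∈ K := ⟨x, hx, rfl⟩
    have h1 := ha (e x) hxK
    rw [iteratedFDeriv_zero_eq_comp, iteratedFDeriv_zero_eq_comp, Function.comp_apply,
      Function.comp_apply, LinearIsometryEquiv.dist_map, dist_eq_norm] at h1
    have h2 : ∀ Z : CrVectorField d r M, vel f Z x =
        fderiv ℝ (immersion f ∘ e.symm) (e x) (localRep e Z (e x)) := by
      intro Z
      have := vel_symm f Z i (hKt hxK)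
      rwa [e.left_inv (hsub x hx)] at this
    rw [h2, h2, dist_eq_norm, ← map_sub]
    calc _ ≤ ‖fderiv ℝ (immersion f ∘ e.symm) (e x)‖ *
            ‖localRep e X (e x) - localRep e (Y a) (e x)‖ :=
          ContinuousLinearMap.le_opNorm _ _
      _ ≤ (|C| + 1) * ‖localRep e X (e x) - localRep e (Y a) (e x)‖ := by
          gcongr
          linarith [hC _ hxK, le_abs_self C]
      _ < (|C| + 1) * (ε / (|C| + 1)) := by gcongr
      _ = ε := by field_simp
  filter_upwards [eventually_all.2 hi] with a ha x
  exact ha _ x (f.apply_ind x (mem_univ x))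

end CrVectorField

/-! ### Lipschitz velocities and local perturbations -/

namespace CrVectorField

lemma exists_lipschitzOnWith_of_contDiffOn {V W : Type*} [NormedAddCommGroup V] [NormedSpace ℝ V]
    [NormedAddCommGroup W] [NormedSpace ℝ W] {g : V → W} {U K : Set V} {n : ℕ∞ω} (hn : 1 ≤ n)
    (hg : ContDiffOn ℝ n g U) (hU : IsOpen U) (hK : IsCompact K) (hKU : K ⊆ U) :
    ∃ C, LipschitzOnWith C g K := by
  refine LocallyLipschitzOn.exists_lipschitzOnWith_of_compact hK fun x hx => ?_
  obtain ⟨C, t, ht, hC⟩ := ((hg.contDiffAt (hU.mem_nhds (hKU hx))).of_le hn).exists_lipschitzOnWith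
  exact ⟨C, t, mem_nhdsWithin_of_mem_nhds ht, hC⟩

variable {d r : ℕ} {M : Type*} [TopologicalSpace M]
  [ChartedSpace (EuclideanSpace ℝ (Fin d)) M] [IsManifold (𝓡 d) ∞ M]
  {κ : Type*} [Fintype κ]
  (f : SmoothBumpCovering κ (𝓡 d) M)

/-- The velocity is `C^1` in a chart, and where the bump is 1 the chart is a component of the
immersion, so chart distances are at most ambient ones. Compactness of the image makes the bound
global, which lets Gronwall apply without following the curves from chart to chart. -/
lemma exists_lipschitz_vel [T2Space M] [CompactSpace M] (hr : 1 ≤ r) (X : CrVectorField d r M) :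
    ∃ K : NNReal, ∀ x y, ‖vel f X x - vel f X y‖ ≤ K * ‖immersion f x - immersion f y‖ := by
  have hemb : IsClosedEmbedding (immersion f) :=
    (continuous_immersion f).isClosedEmbedding (immersion_injective f)
  rcases isEmpty_or_nonempty M with hM | hM
  · exact ⟨0, fun x => hM.elim x⟩
  obtain ⟨g, hg⟩ := (immersion_injective f).hasLeftInverse
  have hloc : LocallyLipschitzOn (range (immersion f)) (vel f X ∘ g) := by
    rintro _ ⟨x, rfl⟩
    set i := f.ind x (mem_univ x)
    set e := chartAt (EuclideanSpace ℝ (Fin d)) (f.c i) with he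
    have hem := IsManifold.subset_maximalAtlas (I := 𝓡 d) (n := ∞) (chart_mem_atlas _ (f.c i))
    have hx : x ∈ e.source := f.mem_chartAt_ind_source x (mem_univ x)
    have hev := f.eventuallyEq_one x (mem_univ x)
    have hsm : ContDiffOn ℝ r (vel f X ∘ e.symm) e.target :=
      contMDiffOn_iff_contDiffOn.1 ((contMDiff_vel f X).comp_contMDiffOn
        ((contMDiffOn_symm_of_mem_maximalAtlas hem).of_le (by exact_mod_cast le_top)))
    obtain ⟨C, t, ht, hC⟩ := ((hsm.contDiffAt
      (e.open_target.mem_nhds (e.map_source hx))).of_le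
      (by exact_mod_cast hr)).exists_lipschitzOnWith
    have hN : {y | f i y = 1 ∧ y ∈ e.source ∧ e y ∈ t} ∈ 𝓝 x :=
      hev.and ((e.open_source.eventually_mem hx).and (e.continuousAt hx ht))
    refine ⟨C, immersion f '' {y | f i y = 1 ∧ y ∈ e.source ∧ e y ∈ t}, ?_, ?_⟩
    · rw [← hemb.isEmbedding.map_nhds_eq x]
      exact image_mem_map hN
    · refine LipschitzOnWith.of_dist_le_mul ?_
      rintro _ ⟨y, ⟨hy1, hys, hyt⟩, rfl⟩ _ ⟨z, ⟨hz1, hzs, hzt⟩, rfl⟩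
      have h1 := hC.dist_le_mul _ hyt _ hzt
      simp only [Function.comp_apply, e.left_inv hys, e.left_inv hzs] at h1
      simp only [Function.comp_apply, hg y, hg z]
      refine h1.trans (mul_le_mul_of_nonneg_left ?_ C.2)
      rw [he, ← immersion_fst_of_eq_one f hy1, ← immersion_fst_of_eq_one f hz1]
      calc _ ≤ dist (immersion f y i) (immersion f z i) := le_max_left _ _
        _ ≤ _ := dist_le_pi_dist _ _ i
  obtain ⟨K, hK⟩ := hloc.exists_lipschitzOnWith_of_compact
    (isCompact_range (continuous_immersion f))
  refine ⟨K, fun x y => ?_⟩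
  have := hK.dist_le_mul _ (mem_range_self x) _ (mem_range_self y)
  simpa only [Function.comp_apply, hg x, hg y, dist_eq_norm] using this

/-- A family of vector fields which are constant near a point of a chart and are supported in a
small ball around that point. -/
lemma exists_bump_field [T2Space M] {p : M} {b : EuclideanSpace ℝ (Fin d)} {ρ : ℝ} (hρ : 0 < ρ)
    (hsub : Metric.closedBall b ρ ⊆ (chartAt (EuclideanSpace ℝ (Fin d)) p).target) :
    ∃ (β : EuclideanSpace ℝ (Fin d) → ℝ) (C : NNReal)
      (Z : EuclideanSpace ℝ (Fin d) →ₗ[ℝ] CrVectorField d r M),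
      LipschitzWith C β ∧ (∀ y, 0 ≤ β y) ∧ (∀ y, β y ≤ 1) ∧
      (∀ y ∈ Metric.closedBall b (ρ / 2), β y = 1) ∧
      (∀ w, ∀ x ∈ (chartAt (EuclideanSpace ℝ (Fin d)) p).source,
        mfderiv (𝓡 d) (𝓡 d) (chartAt (EuclideanSpace ℝ (Fin d)) p) x (Z w x) =
          β (chartAt (EuclideanSpace ℝ (Fin d)) p x) • w) ∧
      ∀ w x, ¬(x ∈ (chartAt (EuclideanSpace ℝ (Fin d)) p).source ∧
        chartAt (EuclideanSpace ℝ (Fin d)) p x ∈ Metric.ball b ρ) → Z w x = 0 := by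
  classical
  set e := chartAt (EuclideanSpace ℝ (Fin d)) p with he
  let β : ContDiffBump b := ⟨ρ / 2, ρ, by positivity, by linarith⟩
  let ψ : M → ℝ := fun x => if x ∈ e.source then β (e x) else 0
  have hψe : ∀ x ∈ e.source, ψ x = β (e x) := fun x hx => if_pos hx
  have hψ0 : ∀ x, ¬(x ∈ e.source ∧ e x ∈ Metric.ball b ρ) → ψ x = 0 := by
    intro x hx
    by_cases hxs : x ∈ e.source
    · rw [hψe x hxs]
      by_contra h
      have : e x ∈ Function.support β := h
      rw [β.support_eq] at this
      exact hx ⟨hxs, this⟩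
    · exact if_neg hxs
  let T := trivializationAt (EuclideanSpace ℝ (Fin d)) (TangentSpace (𝓡 d)) p
  have hT : T.baseSet = e.source := TangentBundle.trivializationAt_baseSet p
  -- The support lies in a compact part of the chart domain, so extension by zero keeps the field
  -- smooth.
  have hts : tsupport ψ ⊆ e.source := by
    have hcl : IsClosed (e.symm '' Metric.closedBall b ρ) :=
      ((isCompact_closedBall b ρ).image_of_continuousOn
        (e.continuousOn_symm.mono hsub)).isClosed
    refine (closure_minimal ?_ hcl).trans ?_
    · intro x hx
      have : x ∈ e.source ∧ e x ∈ Metric.ball b ρ := by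
        by_contra h
        exact hx (hψ0 x h)
      exact ⟨e x, Metric.ball_subset_closedBall this.2, e.left_inv this.1⟩
    · rintro _ ⟨y, hy, rfl⟩
      exact e.map_target (hsub hy)
  have hψs : ContMDiffOn (𝓡 d) 𝓘(ℝ, ℝ) r ψ e.source := by
    have h1 : ContMDiffOn (𝓡 d) (𝓡 d) r e e.source :=
      (contMDiffOn_of_mem_maximalAtlas
        (IsManifold.subset_maximalAtlas (I := 𝓡 d) (n := ∞) (chart_mem_atlas _ p))).of_le
        (by exact_mod_cast le_top)
    have h2 : ContMDiff (𝓡 d) 𝓘(ℝ, ℝ) r β :=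
      (β.contDiff (n := ⊤)).contMDiff.of_le (by exact_mod_cast le_top)
    exact (h2.comp_contMDiffOn h1).congr hψe
  have hsec : ∀ w : EuclideanSpace ℝ (Fin d),
      ContMDiff (𝓡 d) ((𝓡 d).prod 𝓘(ℝ, EuclideanSpace ℝ (Fin d))) r
        (fun x => (⟨x, (ψ • fun x => T.symmL ℝ x w) x⟩ : TangentBundle (𝓡 d) M)) := by
    intro w
    refine ContMDiffOn.smul_section_of_tsupport hψs e.open_source hts ?_
    have : ContMDiffVectorBundle (r : ℕ∞ω) (EuclideanSpace ℝ (Fin d))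
        (TangentSpace (𝓡 d) : M → Type _) (𝓡 d) :=
      ContMDiffVectorBundle.of_le (n := ∞) (by exact_mod_cast le_top)
    rw [← hT]
    rw [T.contMDiffOn_section_baseSet_iff]
    refine (contMDiffOn_const (c := w)).congr fun x hx => ?_
    simp [T.symmL_apply hx, T.apply_mk_symm hx]
  -- The constant section of the trivialization at `p` is the field that the chart sends to `w`; the
  -- cutoff makes it global.
  let Z : EuclideanSpace ℝ (Fin d) →ₗ[ℝ] CrVectorField d r M :=
    { toFun := fun w => ⟨fun x => (ψ • fun x => T.symmL ℝ x w) x, hsec w⟩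
      map_add' := fun w w' => by
        ext x
        change ψ x • T.symmL ℝ x (w + w') = ψ x • T.symmL ℝ x w + ψ x • T.symmL ℝ x w'
        have h : T.symmL ℝ x (w + w') = T.symmL ℝ x w + T.symmL ℝ x w' :=
          (T.symmL ℝ x).map_add w w'
        rw [h, smul_add]
      map_smul' := fun c w => by
        ext x
        change ψ x • T.symmL ℝ x (c • w) = c • (ψ x • T.symmL ℝ x w)
        have h : T.symmL ℝ x (c • w) = c • T.symmL ℝ x w :=
          (T.symmL ℝ x).map_smul c w
        rw [h, smul_comm] }
  obtain ⟨C, hC⟩ := (β.contDiff (n := 1)).lipschitzWith_of_hasCompactSupport β.hasCompactSupport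
    one_ne_zero
  refine ⟨β, C, Z, hC, fun y => β.nonneg, fun y => β.le_one,
    fun y hy => β.one_of_mem_closedBall hy, ?_, ?_⟩
  · intro w x hx
    have h1 : mfderiv (𝓡 d) (𝓡 d) e x (T.symmL ℝ x w) = w := by
      have h2 : T.continuousLinearMapAt ℝ x = mfderiv (𝓡 d) (𝓡 d) e x :=
        TangentBundle.continuousLinearMapAt_trivializationAt hx
      rw [← h2]
      have hxT : x ∈ T.baseSet := hT ▸ hx
      exact T.continuousLinearMapAt_symmL (R := ℝ) hxT w
    refine ((mfderiv (𝓡 d) (𝓡 d) e x).map_smul (ψ x) (T.symmL ℝ x w)).trans ?_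
    rw [hψe x hx]
    exact congrArg (fun u : EuclideanSpace ℝ (Fin d) => β (e x) • u) h1
  · intro w x hx
    change ψ x • T.symmL ℝ x w = 0
    rw [hψ0 x hx, zero_smul]

end CrVectorField

/-! ### Gronwall estimates and limits of integral curves -/

/-- A rate of at least 1 lets `ε / K` be replaced by `ε`; this is why `K + 1` serves as the rate for
a `K`-Lipschitz field. -/
lemma gronwallBound_le_mul_exp {δ K ε T t : ℝ} (hδ : 0 ≤ δ) (hK : 1 ≤ K) (hε : 0 ≤ ε)
    (ht : t ≤ T) : gronwallBound δ K ε t ≤ (δ + ε) * Real.exp (K * T) := by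
  rw [gronwallBound_of_K_ne_0 (by linarith)]
  have h1 : Real.exp (K * t) ≤ Real.exp (K * T) := Real.exp_le_exp.2 (by gcongr)
  have h2 : ε / K ≤ ε := div_le_self hε hK
  have h3 : 0 ≤ ε / K := by positivity
  nlinarith [Real.exp_pos (K * T), Real.exp_pos (K * t),
    mul_le_mul h2 h1 (Real.exp_pos _).le hε, mul_le_mul_of_nonneg_left h1 hδ]

section Curves

variable {F : Type*} [NormedAddCommGroup F] [NormedSpace ℝ F]

lemma norm_le_of_norm_deriv_le {u u' : ℝ → F} {K ε T : ℝ} (hK : 1 ≤ K) (hε : 0 ≤ ε)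
    (hu : ∀ t ∈ Icc 0 T, HasDerivAt u (u' t) t) (hb : ∀ t ∈ Icc 0 T, ‖u' t‖ ≤ K * ‖u t‖ + ε)
    {t : ℝ} (ht : t ∈ Icc 0 T) : ‖u t‖ ≤ (‖u 0‖ + ε) * Real.exp (K * T) := by
  refine (norm_le_gronwallBound_of_norm_deriv_right_le (K := K) (ε := ε)
    (fun s hs => (hu s hs).continuousAt.continuousWithinAt)
    (fun s hs => (hu s (Ico_subset_Icc_self hs)).hasDerivWithinAt) le_rfl
    (fun s hs => hb s (Ico_subset_Icc_self hs)) t ht).trans ?_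
  rw [sub_zero]
  exact gronwallBound_le_mul_exp (norm_nonneg _) hK hε ht.2

lemma norm_le_of_norm_deriv_le_symm {u u' : ℝ → F} {K ε T : ℝ} (hK : 1 ≤ K) (hε : 0 ≤ ε)
    (hu : ∀ t, HasDerivAt u (u' t) t) (hb : ∀ t, ‖u' t‖ ≤ K * ‖u t‖ + ε)
    {t : ℝ} (ht : t ∈ Icc (-T) T) : ‖u t‖ ≤ (‖u 0‖ + ε) * Real.exp (K * T) := by
  rcases le_total 0 t with h | h
  · exact norm_le_of_norm_deriv_le hK hε (fun s _ => hu s) (fun s _ => hb s) ⟨h, ht.2⟩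
  · have h1 : ∀ s, HasDerivAt (fun s => u (-s)) (-u' (-s)) s := fun s => by
      simpa [Function.comp_def] using (hu (-s)).scomp s (hasDerivAt_neg s)
    have h2 := norm_le_of_norm_deriv_le (T := T) hK hε (fun s _ => h1 s)
      (fun s _ => by simpa using hb (-s)) (t := -t) ⟨by linarith, by linarith [ht.1]⟩
    simpa using h2

variable {M : Type*} [TopologicalSpace M]

/-- `γ` is an integral curve of the vector field with velocity `v`, as seen through `ι`. -/
def IsCurve (ι v : M → F) (γ : ℝ → M) : Prop := ∀ t, HasDerivAt (ι ∘ γ) (v (γ t)) t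

lemma IsCurve.comp_add {ι v : M → F} {γ : ℝ → M} (h : IsCurve ι v γ) (c : ℝ) :
    IsCurve ι v (fun t => γ (t + c)) := fun t => (h (t + c)).comp_add_const t c

/-- Integral curves of a convergent family of vector fields subconverge to an integral curve. -/
lemma exists_limit_curve [CompactSpace M] [T2Space M] {ι : M → F} (hι : Continuous ι)
    (hinj : Function.Injective ι) {v₀ : M → F} {K : NNReal}
    (hv : ∀ x y, ‖v₀ x - v₀ y‖ ≤ K * ‖ι x - ι y‖) {α : Type*} (U : Ultrafilter α)
    {v : α → M → F} (hlim : TendstoUniformly v v₀ U) {γ : α → ℝ → M}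
    (hγ : ∀ᶠ a in (U : Filter α), IsCurve ι (v a) (γ a)) :
    ∃ γ₀ : ℝ → M, IsCurve ι v₀ γ₀ ∧ ∀ (s : α → ℝ) (t : ℝ), Tendsto s U (𝓝 t) →
      Tendsto (fun a => γ a (s a)) U (𝓝 (γ₀ t)) := by
  have hemb : IsClosedEmbedding ι := hι.isClosedEmbedding hinj
  have hpt : ∀ t, ∃ x, Tendsto (fun a => γ a t) U (𝓝 x) := fun t => by
    obtain ⟨x, -, hx⟩ := isCompact_univ.ultrafilter_le_nhds (U.map fun a => γ a t) (by simp)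
    exact ⟨x, hx⟩
  choose γ₀ hγ₀ using hpt
  have hpt' : ∀ t, Tendsto (fun a => ι (γ a t)) U (𝓝 (ι (γ₀ t))) := fun t =>
    (hι.tendsto _).comp (hγ₀ t)
  rw [Metric.tendstoUniformly_iff] at hlim
  have hunif : ∀ T ε, 0 < ε → ∀ᶠ a in (U : Filter α), ∀ t ∈ Icc (-T) T,
      ‖ι (γ a t) - ι (γ₀ t)‖ < ε := by
    intro T ε hε
    set C := Real.exp ((K + 1) * T) with hC
    have hCpos : 0 < C := Real.exp_pos _
    -- One `η` pays for the initial gap and two for the velocity errors, so the total is `3 * η * C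
    -- < ε`.
    set η := ε / (4 * C) with hη
    have hηpos : 0 < η := by positivity
    have h0 := Metric.tendsto_nhds.1 (hpt' 0) η hηpos
    filter_upwards [hγ, hlim η hηpos, h0] with a ha1 ha2 ha3 t ht
    -- The limit is not yet known to be a curve, so two members of the family are compared and then
    -- `b` goes to the limit.
    have hab : ∀ᶠ b in (U : Filter α), ‖ι (γ a t) - ι (γ b t)‖ ≤
        (‖ι (γ a 0) - ι (γ b 0)‖ + 2 * η) * C := by
      filter_upwards [hγ, hlim η hηpos] with b hb1 hb2
      refine norm_le_of_norm_deriv_le_symm (u := fun t => ι (γ a t) - ι (γ b t))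
        (u' := fun t => v a (γ a t) - v b (γ b t)) (K := K + 1) (by linarith [K.2]) (by positivity)
        (fun s => (ha1 s).sub (hb1 s)) (fun s => ?_) ht
      have h1 := ha2 (γ a s)
      have h2 := hb2 (γ b s)
      rw [dist_comm, dist_eq_norm] at h1
      rw [dist_eq_norm] at h2
      have h3 := hv (γ a s) (γ b s)
      have h4 : v a (γ a s) - v b (γ b s) = (v a (γ a s) - v₀ (γ a s)) +
        (v₀ (γ a s) - v₀ (γ b s)) + (v₀ (γ b s) - v b (γ b s)) := by abel
      rw [h4]
      refine (norm_add₃_le).trans ?_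
      nlinarith [norm_nonneg (ι (γ a s) - ι (γ b s))]
    have hle := le_of_tendsto_of_tendsto
      ((tendsto_const_nhds.sub (hpt' t)).norm)
      ((((tendsto_const_nhds.sub (hpt' 0)).norm).add_const (2 * η)).mul_const C) hab
    refine hle.trans_lt ?_
    rw [dist_eq_norm] at ha3
    calc _ < (η + 2 * η) * C := by gcongr
      _ = 3 / 4 * ε := by rw [hη]; field_simp; ring
      _ < ε := by linarith
  have hcurve : IsCurve ι v₀ γ₀ := by
    intro t
    have hder : TendstoUniformlyOn (fun a t => v a (γ a t)) (fun t => v₀ (γ₀ t)) U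
        (Ioo (-(|t| + 1)) (|t| + 1)) := by
      rw [Metric.tendstoUniformlyOn_iff]
      intro ε hε
      filter_upwards [hlim (ε / 2) (by positivity),
        hunif (|t| + 1) (ε / (2 * (K + 1))) (by positivity)] with a h1 h2 s hs
      have h3 := h2 s (Ioo_subset_Icc_self hs)
      have h4 := hv (γ₀ s) (γ a s)
      refine (dist_triangle _ (v₀ (γ a s)) _).trans_lt ?_
      rw [dist_eq_norm]
      have h5 : ‖v₀ (γ₀ s) - v₀ (γ a s)‖ ≤ ε / 2 := by
        rw [norm_sub_rev] at h3
        calc _ ≤ (K : ℝ) * ‖ι (γ₀ s) - ι (γ a s)‖ := h4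
          _ ≤ (K + 1) * (ε / (2 * (K + 1))) := by gcongr; linarith
          _ = ε / 2 := by field_simp
      linarith [h1 (γ a s)]
    refine hasDerivAt_of_tendstoUniformlyOn isOpen_Ioo hder ?_ (fun s _ => hpt' s)
      (by constructor <;> linarith [abs_nonneg t, neg_abs_le t, le_abs_self t])
    filter_upwards [hγ] with a ha s _ using ha s
  refine ⟨γ₀, hcurve, fun s t hs => ?_⟩
  rw [hemb.isEmbedding.tendsto_nhds_iff]
  -- Pointwise limits do not handle moving times `s a`; locally uniform ones do.
  have h1 : TendstoLocallyUniformly (fun a t => ι (γ a t)) (ι ∘ γ₀) U := by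
    rw [Metric.tendstoLocallyUniformly_iff]
    intro ε hε x
    refine ⟨Icc (-(|x| + 1)) (|x| + 1), Icc_mem_nhds (by linarith [neg_abs_le x])
      (by linarith [le_abs_self x]), ?_⟩
    filter_upwards [hunif (|x| + 1) ε hε] with a ha y hy
    rw [dist_comm, dist_eq_norm]
    exact ha y hy
  exact h1.tendsto_comp (hcurve t).continuousAt hs

/-- Two curves that follow, up to times `S` and `S'`, the same Lipschitz vector field are close at
an earlier time `τ` if they are close at the end. -/
lemma norm_sub_le_of_backward {ι v : M → F} {K : NNReal} {V N : ℝ}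
    (hv : ∀ x y, ‖v x - v y‖ ≤ K * ‖ι x - ι y‖) (hV : ∀ x, ‖v x‖ ≤ V)
    {γ δ : ℝ → M} {τ S S' : ℝ} (hτ : 0 ≤ τ) (hS : τ ≤ S) (hSS' : S ≤ S') (hN : S ≤ N)
    (hγ : ∀ t ∈ Icc τ S, HasDerivAt (ι ∘ γ) (v (γ t)) t)
    (hδ : ∀ t ∈ Icc τ S', HasDerivAt (ι ∘ δ) (v (δ t)) t) :
    ‖ι (γ τ) - ι (δ τ)‖ ≤ ‖ι (γ S) - ι (δ S')‖ * Real.exp ((K + 1) * N) + V * |S - S'| := by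
  -- Both curves run backwards for the same duration `S - τ`, so `δ` stops at `τ + S' - S`; its
  -- remaining motion costs speed times `|S - S'|`.
  have h1 : ‖ι (γ τ) - ι (δ (τ + S' - S))‖ ≤ ‖ι (γ S) - ι (δ S')‖ * Real.exp ((K + 1) * N) := by
    have h := norm_le_of_norm_deriv_le (u := fun t => ι (γ (S - t)) - ι (δ (S' - t)))
      (u' := fun t => -v (γ (S - t)) - -v (δ (S' - t))) (K := K + 1) (ε := 0) (T := S - τ)
      (by linarith [K.2]) le_rfl ?_ ?_ (t := S - τ) ⟨by linarith, le_rfl⟩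
    · simp only [sub_sub_cancel, sub_zero, add_zero] at h
      rw [show S' - (S - τ) = τ + S' - S by ring] at h
      refine h.trans (mul_le_mul_of_nonneg_left (Real.exp_le_exp.2 ?_) (norm_nonneg _))
      have := K.2
      gcongr
      linarith
    · intro t ht
      have h1 := (hγ (S - t) ⟨by linarith [ht.2], by linarith [ht.1]⟩).scomp t
        ((hasDerivAt_id t).const_sub S)
      have h2 := (hδ (S' - t) ⟨by linarith [ht.2], by linarith [ht.1]⟩).scomp t
        ((hasDerivAt_id t).const_sub S')
      simpa [Function.comp_def, Pi.sub_def] using h1.sub h2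
    · intro t _
      have := hv (γ (S - t)) (δ (S' - t))
      rw [← neg_add', norm_neg, ← sub_eq_add_neg]
      nlinarith [norm_nonneg (ι (γ (S - t)) - ι (δ (S' - t)))]
  have h2 : ‖ι (δ (τ + S' - S)) - ι (δ τ)‖ ≤ V * |S - S'| := by
    have := (convex_Icc τ S').norm_image_sub_le_of_norm_hasDerivWithin_le
      (f := ι ∘ δ) (C := V) (fun t ht => (hδ t ht).hasDerivWithinAt) (fun t _ => hV _)
      (x := τ) (y := τ + S' - S) ⟨le_rfl, by linarith⟩ ⟨by linarith, by linarith⟩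
    rw [show τ + S' - S - τ = -(S - S') by ring, norm_neg, Real.norm_eq_abs] at this
    exact this
  calc _ ≤ ‖ι (γ τ) - ι (δ (τ + S' - S))‖ + ‖ι (δ (τ + S' - S)) - ι (δ τ)‖ :=
        norm_sub_le_norm_sub_add_norm_sub _ _ _
    _ ≤ _ := add_le_add h1 h2

end Curves

/-! ### Hausdorff dimension and the crossing of a bump -/

/-- A set which is the image of a subset of a space of smaller dimension under a Lipschitz map has
empty interior. -/
lemma interior_eq_empty_of_antilipschitz {V W : Type*} [NormedAddCommGroup V] [NormedSpace ℝ V]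
    [FiniteDimensional ℝ V] [NormedAddCommGroup W] [NormedSpace ℝ W] [FiniteDimensional ℝ W]
    (hdim : Module.finrank ℝ W < Module.finrank ℝ V) {s : Set V} (φ : V → W) (K : NNReal)
    (h : ∀ x ∈ s, ∀ y ∈ s, ‖x - y‖ ≤ K * ‖φ x - φ y‖) : interior s = ∅ := by
  by_contra hne
  have h1 := Real.dimH_of_nonempty_interior (nonempty_iff_ne_empty.2 hne)
  -- An antilipschitz map cannot lower Hausdorff dimension, so `s` has dimension at most that of
  -- `W`.
  have hanti : AntilipschitzWith K (fun x : s => φ x) :=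
    AntilipschitzWith.of_le_mul_dist fun x y => by
      simpa only [Subtype.dist_eq, dist_eq_norm] using h x x.2 y y.2
  have h2 : dimH s = dimH (univ : Set s) := by
    conv_lhs => rw [← Subtype.coe_image_univ s]
    exact isometry_subtype_coe.dimH_image _
  have h3 := (hanti.le_dimH_image univ).trans (dimH_mono (subset_univ _))
  rw [Real.dimH_univ_eq_finrank, ← h2, h1] at h3
  exact absurd h3 (not_le.2 (by exact_mod_cast hdim))

/-- The endpoint of a trajectory crossing the support of a bump depends in a bi-Lipschitz way on
the vector by which the bump pushes the trajectory. -/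
lemma norm_sub_le_of_transit {V : Type*} [NormedAddCommGroup V] [InnerProductSpace ℝ V]
    {b v w w' : V} {τ : ℝ} (hτ : 0 < τ) {β : V → ℝ} {C : NNReal} (hβ : LipschitzWith C β)
    (hβ0 : ∀ y, 0 ≤ β y) (hβ1 : ∀ y, β y ≤ 1)
    (hβb : ∀ y ∈ Metric.closedBall b (τ * ‖v‖ / 4), β y = 1)
    {p q A B : ℝ → V}
    (hp : ∀ t ∈ Icc 0 (2 * τ), HasDerivAt p (A t + β (p t) • w) t)
    (hq : ∀ t ∈ Icc 0 (2 * τ), HasDerivAt q (B t + β (q t) • w') t)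
    (hAB : ∀ t ∈ Icc 0 (2 * τ), ‖A t - B t‖ ≤ 1 / (100 * τ) * ‖p t - q t‖)
    (htube : ∀ t ∈ Icc 0 (2 * τ), ‖p t - (b + (t - τ) • v)‖ ≤ τ * ‖v‖ / 8)
    (hw' : C * ‖w'‖ * τ ≤ 1 / 100) :
    τ / 20 * ‖w - w'‖ ≤ ‖p (2 * τ) - q (2 * τ)‖ + 2 * ‖p 0 - q 0‖ := by
  set δ := ‖w - w'‖ with hδ
  set u : ℝ → V := fun t => p t - q t with hu
  -- `R` collects everything in `u'` except the push by `w - w'`, weighted by the bump along `p`;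
  -- hence only `p` needs the tube and only `w'` a bound.
  set R : ℝ → V := fun t => (A t - B t) + (β (p t) - β (q t)) • w' with hR
  have hder : ∀ t ∈ Icc 0 (2 * τ), HasDerivAt u (R t + β (p t) • (w - w')) t := by
    intro t ht
    have h : R t + β (p t) • (w - w') = (A t + β (p t) • w) - (B t + β (q t) • w') := by
      simp only [hR]
      module
    rw [h]
    exact (hp t ht).sub (hq t ht)
  have hRb : ∀ t ∈ Icc 0 (2 * τ), ‖R t‖ ≤ 1 / (50 * τ) * ‖u t‖ := by
    intro t ht
    have h1 := hβ.dist_le_mul (p t) (q t)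
    rw [dist_eq_norm, dist_eq_norm] at h1
    have h2 : C * ‖w'‖ ≤ 1 / (100 * τ) := by
      rw [le_div_iff₀ (by positivity)]; linarith
    calc ‖R t‖ ≤ ‖A t - B t‖ + ‖β (p t) - β (q t)‖ * ‖w'‖ :=
          (norm_add_le _ _).trans (by rw [norm_smul])
      _ ≤ 1 / (100 * τ) * ‖u t‖ + C * ‖u t‖ * ‖w'‖ := by
          gcongr
          exact hAB t ht
      _ = 1 / (100 * τ) * ‖u t‖ + (C * ‖w'‖) * ‖u t‖ := by ring
      _ ≤ 1 / (100 * τ) * ‖u t‖ + 1 / (100 * τ) * ‖u t‖ := by gcongr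
      _ = 1 / (50 * τ) * ‖u t‖ := by ring
  have hub : ∀ t ∈ Icc 0 (2 * τ), ‖u t‖ ≤ 2 * ‖u 0‖ + 4 * τ * δ := by
    intro t ht
    have h1 := norm_le_gronwallBound_of_norm_deriv_right_le (f := u)
      (f' := fun t => R t + β (p t) • (w - w')) (δ := ‖u 0‖) (K := 1 / (50 * τ)) (ε := δ)
      (a := 0) (b := 2 * τ) (fun s hs => (hder s hs).continuousAt.continuousWithinAt)
      (fun s hs => (hder s (Ico_subset_Icc_self hs)).hasDerivWithinAt) le_rfl
      (fun s hs => (norm_add_le _ _).trans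
        (add_le_add (hRb s (Ico_subset_Icc_self hs)) (by
          rw [norm_smul, Real.norm_of_nonneg (hβ0 _)]
          exact mul_le_of_le_one_left (norm_nonneg _) (hβ1 _)))) t ht
    rw [sub_zero, gronwallBound_of_K_ne_0 (by positivity)] at h1
    set z := 1 / (50 * τ) * t with hz
    have hz0 : 0 ≤ z := by have := ht.1; positivity
    -- The rate `1 / (50 * τ)` over a time of at most `2 * τ` leaves a small exponent.
    have hz1 : z ≤ 1 / 25 := by
      rw [hz]
      calc _ ≤ 1 / (50 * τ) * (2 * τ) := by gcongr; exact ht.2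
        _ = 1 / 25 := by field_simp; norm_num
    have h2 := Real.abs_exp_sub_one_le (x := z) (by rw [abs_of_nonneg hz0]; linarith)
    rw [abs_of_nonneg hz0] at h2
    have h3 : Real.exp z - 1 ≤ 2 / 25 := (le_abs_self _).trans (by linarith)
    have h4 : δ / (1 / (50 * τ)) * (Real.exp z - 1) ≤ δ / (1 / (50 * τ)) * (2 / 25) :=
      mul_le_mul_of_nonneg_left h3 (by positivity)
    have h5 : δ / (1 / (50 * τ)) * (2 / 25) = 4 * τ * δ := by field_simp; ring
    nlinarith [norm_nonneg (u 0)]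
  -- In the direction `w - w'` the push never acts negatively, so its effect cannot cancel during
  -- the crossing.
  set h : ℝ → ℝ := fun t => inner ℝ (u t) (w - w') with hh
  have hhd : ∀ t ∈ Icc 0 (2 * τ),
      HasDerivAt h (inner ℝ (R t) (w - w') + β (p t) * δ ^ 2) t := by
    intro t ht
    have h := (hder t ht).inner ℝ (hasDerivAt_const t (w - w'))
    rwa [inner_zero_right, zero_add, inner_add_left, real_inner_smul_left,
      real_inner_self_eq_norm_sq] at h
  set m := 1 / (50 * τ) * (2 * ‖u 0‖ + 4 * τ * δ) * δ with hm
  have hRm : ∀ t ∈ Icc 0 (2 * τ), -m ≤ inner ℝ (R t) (w - w') := by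
    intro t ht
    have h1 := abs_real_inner_le_norm (R t) (w - w')
    have h2 : ‖R t‖ * ‖w - w'‖ ≤ m := by
      rw [hm, ← hδ]
      gcongr
      refine (hRb t ht).trans ?_
      gcongr
      exact hub t ht
    linarith [neg_abs_le (inner ℝ (R t) (w - w'))]
  have hmono : ∀ a a' c, 0 ≤ a → a ≤ a' → a' ≤ 2 * τ → (∀ t ∈ Ioo a a', c ≤ β (p t)) →
      (c * δ ^ 2 - m) * (a' - a) ≤ h a' - h a := by
    intro a a' c ha haa' ha' hc
    have hsub : ∀ t ∈ Icc a a', t ∈ Icc 0 (2 * τ) := fun t ht =>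
      ⟨ha.trans ht.1, ht.2.trans ha'⟩
    refine (convex_Icc a a').mul_sub_le_image_sub_of_le_deriv
      (fun t ht => (hhd t (hsub t ht)).continuousAt.continuousWithinAt)
      (fun t ht => (hhd t (hsub t (interior_subset ht))).differentiableAt.differentiableWithinAt)
      (fun t ht => ?_) a ⟨le_rfl, haa'⟩ a' ⟨haa', le_rfl⟩ haa'
    rw [(hhd t (hsub t (interior_subset ht))).deriv]
    rw [interior_Icc] at ht
    have := hRm t (hsub t (Ioo_subset_Icc_self ht))
    nlinarith [hc t ht, sq_nonneg δ]
  have h1 := hmono 0 (7 * τ / 8) 0 le_rfl (by linarith) (by linarith) fun t _ => hβ0 _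
  -- Within `τ / 8` of the middle time the tube keeps `p` where the bump is 1; this window
  -- contributes `τ / 4 * δ ^ 2`.
  have h2 := hmono (7 * τ / 8) (9 * τ / 8) 1 (by linarith) (by linarith) (by linarith) fun t ht => by
    refine (hβb _ ?_).ge
    rw [mem_closedBall_iff_norm]
    have h3 := htube t ⟨by linarith [ht.1], by linarith [ht.2]⟩
    have h4 : ‖(t - τ) • v‖ ≤ τ / 8 * ‖v‖ := by
      rw [norm_smul, Real.norm_eq_abs]
      gcongr
      rw [abs_le]
      constructor <;> linarith [ht.1, ht.2]
    calc ‖p t - b‖ = ‖(p t - (b + (t - τ) • v)) + (t - τ) • v‖ := by congr 1; abel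
      _ ≤ τ * ‖v‖ / 8 + τ / 8 * ‖v‖ := (norm_add_le _ _).trans (add_le_add h3 h4)
      _ = τ * ‖v‖ / 4 := by ring
  have h3 := hmono (9 * τ / 8) (2 * τ) 0 (by linarith) (by linarith) le_rfl fun t _ => hβ0 _
  have h4 : h (2 * τ) - h 0 ≤ (‖u (2 * τ)‖ + ‖u 0‖) * δ := by
    have h5 := real_inner_le_norm (u (2 * τ)) (w - w')
    have h6 := neg_le_of_abs_le (abs_real_inner_le_norm (u 0) (w - w'))
    simp only [hh]
    rw [add_mul]
    linarith
  have hm' : 2 * τ * m = 2 / 25 * ‖u 0‖ * δ + 4 / 25 * τ * δ ^ 2 := by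
    rw [hm]; field_simp; ring
  -- The gain `1/4` minus the loss `4/25` leaves `9/100`.
  have h5 : δ * (9 / 100 * τ * δ) ≤ δ * (‖u (2 * τ)‖ + 27 / 25 * ‖u 0‖) := by nlinarith
  have hδ0 : 0 ≤ δ := norm_nonneg _
  change τ / 20 * δ ≤ ‖u (2 * τ)‖ + 2 * ‖u 0‖
  rcases hδ0.eq_or_lt with h0 | hpos
  · rw [← h0, mul_zero]; positivity
  · have h6 := le_of_mul_le_mul_left h5 hpos
    nlinarith [norm_nonneg (u 0), mul_pos hτ hpos]

/-! ### Boxes, loops, and closedness of the bad sets -/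

namespace CrVectorField

variable {d r : ℕ} {M : Type*} [TopologicalSpace M]
  [ChartedSpace (EuclideanSpace ℝ (Fin d)) M] [IsManifold (𝓡 d) ∞ M]
  {κ : Type*} [Fintype κ]
  (f : SmoothBumpCovering κ (𝓡 d) M)

/-- The `i`-th chart, cut off by the `i`-th bump function. -/
def coord (i : κ) (x : M) : EuclideanSpace ℝ (Fin d) := (immersion f x i).1

lemma coord_of_eq_one {i : κ} {x : M} (h : f i x = 1) :
    coord f i x = chartAt (EuclideanSpace ℝ (Fin d)) (f.c i) x :=
  immersion_fst_of_eq_one f h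

lemma norm_coord_sub_le (i : κ) (x y : M) :
    ‖coord f i x - coord f i y‖ ≤ ‖immersion f x - immersion f y‖ :=
  (norm_fst_le (immersion f x i - immersion f y i)).trans
    (norm_le_pi_norm (immersion f x - immersion f y) i)

lemma norm_vel_fst_sub_le (X : CrVectorField d r M) (i : κ) (x y : M) :
    ‖(vel f X x i).1 - (vel f X y i).1‖ ≤ ‖vel f X x - vel f X y‖ :=
  (norm_fst_le (vel f X x i - vel f X y i)).trans (norm_le_pi_norm (vel f X x - vel f X y) i)

lemma continuous_coord [T2Space M] (i : κ) : Continuous (coord f i) :=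
  continuous_fst.comp ((continuous_apply i).comp (continuous_immersion f))

/-- A box in a chart, crossed in the direction `dir` during the time `2 * dur`, with middle point
`center`, and entered through the hyperplane of the points whose inner product with `dir` is
`level`. -/
structure Box (d : ℕ) (κ : Type*) where
  chart : κ
  dir : EuclideanSpace ℝ (Fin d)
  center : EuclideanSpace ℝ (Fin d)
  level : ℝ
  dur : ℝ

namespace Box

/-- The closed ball around the middle of the box. -/
def ball (α : Box d κ) : Set (EuclideanSpace ℝ (Fin d)) :=
  Metric.closedBall α.center (2 * α.dur * ‖α.dir‖)

/-- The box lies well inside the domain of its chart. -/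
structure IsValid (α : Box d κ) : Prop where
  dur_pos : 0 < α.dur
  dir_ne : α.dir ≠ 0
  mem_target : ∀ y ∈ α.ball, y ∈ (chartAt (EuclideanSpace ℝ (Fin d)) (f.c α.chart)).target
  eq_one : ∀ y ∈ α.ball,
    f α.chart ((chartAt (EuclideanSpace ℝ (Fin d)) (f.c α.chart)).symm y) = 1

/-- The region around the middle of the box where vector fields are perturbed. -/
def core (α : Box d κ) : Set M :=
  {x | x ∈ (chartAt (EuclideanSpace ℝ (Fin d)) (f.c α.chart)).source ∧
    chartAt (EuclideanSpace ℝ (Fin d)) (f.c α.chart) x ∈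
      Metric.ball α.center (α.dur * ‖α.dir‖ / 2)}

/-- The vector field varies slowly in the box. -/
def IsGood (α : Box d κ) (X : CrVectorField d r M) : Prop :=
  ∀ x y, f α.chart x = 1 → f α.chart y = 1 → coord f α.chart x ∈ α.ball →
    coord f α.chart y ∈ α.ball → ‖(vel f X x α.chart).1 - (vel f X y α.chart).1‖ ≤
      1 / (100 * α.dur) * ‖coord f α.chart x - coord f α.chart y‖

/-- `γ` is an integral curve of `X` that enters the box at time `0`, crosses it, and returns at time
`S` without crossing the core of the box again and without meeting `A`. -/
structure IsLoop (α : Box d κ) (A : Set M) (N : ℝ) (X : CrVectorField d r M) (γ : ℝ → M)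
    (S : ℝ) : Prop where
  curve : IsCurve (immersion f) (vel f X) γ
  dur_le : 2 * α.dur ≤ S
  le : S ≤ N
  closed : γ S = γ 0
  level : inner ℝ (coord f α.chart (γ 0)) α.dir = α.level
  eq_one : ∀ t ∈ Icc 0 (2 * α.dur), f α.chart (γ t) = 1
  tube : ∀ t ∈ Icc 0 (2 * α.dur),
    ‖coord f α.chart (γ t) - (α.center + (t - α.dur) • α.dir)‖ ≤ α.dur * ‖α.dir‖ / 8
  avoid_core : ∀ t ∈ Icc (2 * α.dur) S, γ t ∉ α.core f
  avoid : ∀ t ∈ Icc 0 S, γ t ∉ A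

variable {f} {α α' : Box d κ} {A : Set M} {N : ℝ} {X : CrVectorField d r M}

lemma isOpen_core : IsOpen (α.core f) :=
  (chartAt (EuclideanSpace ℝ (Fin d)) (f.c α.chart)).isOpen_inter_preimage Metric.isOpen_ball

/-- Return times lie in the compact interval from `2 * α.dur` to `N`, so they converge along the
ultrafilter. The remaining clauses are equalities, weak inequalities, or avoidance of open sets, all
closed conditions. -/
lemma IsLoop.exists_limit [T2Space M] [CompactSpace M] (hr : 1 ≤ r) (hα : 0 ≤ α.dur)
    (hA : IsOpen A) {U : Ultrafilter (CrVectorField d r M)} (hU : (U : Filter _) ≤ 𝓝 X)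
    {γ : CrVectorField d r M → ℝ → M} {S : CrVectorField d r M → ℝ}
    (h : ∀ᶠ Y in (U : Filter (CrVectorField d r M)), α.IsLoop f A N Y (γ Y) (S Y)) :
    ∃ γ₀ S₀, α.IsLoop f A N X γ₀ S₀ ∧ Tendsto S U (𝓝 S₀) := by
  obtain ⟨K, hK⟩ := exists_lipschitz_vel f hr X
  obtain ⟨γ₀, hγ₀, hlim⟩ := exists_limit_curve (continuous_immersion f) (immersion_injective f) hK U
    (v := fun Y => vel f Y) (tendstoUniformly_vel f (Y := fun Y => Y) hU)
    (h.mono fun Y hY => hY.curve)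
  obtain ⟨S₀, hS₀, hS⟩ := (isCompact_Icc (a := 2 * α.dur) (b := N)).ultrafilter_le_nhds
    (U.map S) (by
      rw [le_principal_iff]
      exact h.mono fun Y hY => ⟨hY.dur_le, hY.le⟩)
  have hS : Tendsto S U (𝓝 S₀) := hS
  -- A time `t ≤ S₀` may exceed `S Y`; truncating it gives an admissible time with the same limit.
  have hmin : ∀ t, t ≤ S₀ → Tendsto (fun Y => min t (S Y)) U (𝓝 t) := fun t ht => by
    simpa [min_eq_left ht] using (tendsto_const_nhds (x := t)).min hS
  have hpt : ∀ t, Tendsto (fun Y => γ Y t) U (𝓝 (γ₀ t)) := fun t => hlim _ t tendsto_const_nhds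
  refine ⟨γ₀, S₀, ⟨hγ₀, hS₀.1, hS₀.2, ?_, ?_, fun t ht => ?_, fun t ht => ?_, fun t ht hc => ?_,
    fun t ht hc => ?_⟩, hS⟩
  · refine tendsto_nhds_unique (hlim S S₀ hS) ((hpt 0).congr' ?_)
    exact h.mono fun Y hY => hY.closed.symm
  · refine tendsto_nhds_unique (((continuous_coord f α.chart).tendsto _).comp (hpt 0)
      |>.inner tendsto_const_nhds) (tendsto_const_nhds.congr' ?_)
    exact h.mono fun Y hY => hY.level.symm
  · exact tendsto_nhds_unique (((f α.chart).continuous.tendsto _).comp (hpt t))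
      (tendsto_const_nhds.congr' (h.mono fun Y hY => (hY.eq_one t ht).symm))
  · exact le_of_tendsto ((((continuous_coord f α.chart).tendsto _).comp (hpt t)).sub_const _).norm
      (h.mono fun Y hY => hY.tube t ht)
  · obtain ⟨Y, hY, hY'⟩ := (h.and ((hlim _ t (hmin t ht.2)).eventually
      (isOpen_core.eventually_mem hc))).exists
    exact hY.avoid_core _ ⟨le_min ht.1 hY.dur_le, min_le_right _ _⟩ hY'
  · obtain ⟨Y, hY, hY'⟩ := (h.and ((hlim _ t (hmin t ht.2)).eventually
      (hA.eventually_mem hc))).exists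
    exact hY.avoid _ ⟨le_min ht.1 (by linarith [hY.dur_le]), min_le_right _ _⟩ hY'

lemma isClosed_isGood [T2Space M] [CompactSpace M] :
    IsClosed {X : CrVectorField d r M | α.IsGood f X} := by
  rw [isClosed_iff_ultrafilter]
  intro X U hU hmem x y hx hy hx' hy'
  have h := tendstoUniformly_vel f (Y := fun Y => Y) hU
  have hc : Continuous fun w : κ → EuclideanSpace ℝ (Fin d) × ℝ => (w α.chart).1 :=
    continuous_fst.comp (continuous_apply α.chart)
  have hpt : ∀ z, Tendsto (fun Y : CrVectorField d r M => (vel f Y z α.chart).1) (U : Filter _) 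
      (𝓝 (vel f X z α.chart).1) := fun z =>
    (hc.tendsto (vel f X z)).comp (h.tendsto_at z)
  refine le_of_tendsto ((hpt x).sub (hpt y)).norm ?_
  filter_upwards [hmem] with Y hY using hY x y hx hy hx' hy'

variable (f) in
/-- The vector fields having a loop through each of two boxes, with a given ratio of the return
times. -/
def bad (α α' : Box d κ) (c N : ℝ) : Set (CrVectorField d r M) :=
  {X | α.IsGood f X ∧ α'.IsGood f X ∧ ∃ γ S γ' S', α.IsLoop f (α'.core f) N X γ S ∧
    α'.IsLoop f (α.core f) N X γ' S' ∧ S = c * S'}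

lemma isClosed_bad [T2Space M] [CompactSpace M] (hr : 1 ≤ r) (hα : 0 ≤ α.dur) (hα' : 0 ≤ α'.dur)
    (c N : ℝ) : IsClosed (bad f α α' c N : Set (CrVectorField d r M)) := by
  rw [isClosed_iff_ultrafilter]
  intro X U hU hmem
  refine ⟨isClosed_iff_ultrafilter.1 isClosed_isGood X U hU (mem_of_superset hmem fun Y hY => hY.1),
    isClosed_iff_ultrafilter.1 isClosed_isGood X U hU (mem_of_superset hmem fun Y hY => hY.2.1), ?_⟩
  have hmem' : ∀ Y : CrVectorField d r M, ∃ γ S γ' S', Y ∈ bad f α α' c N →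
      α.IsLoop f (α'.core f) N Y γ S ∧ α'.IsLoop f (α.core f) N Y γ' S' ∧ S = c * S' := by
    intro Y
    by_cases hY : Y ∈ bad f α α' c N
    · obtain ⟨-, -, γ, S, γ', S', h⟩ := hY
      exact ⟨γ, S, γ', S', fun _ => h⟩
    · obtain ⟨Z, -, -, γ, -⟩ := U.nonempty_of_mem hmem
      exact ⟨γ, 0, γ, 0, fun h => absurd h hY⟩
  choose γ S γ' S' h using hmem'
  have h' := mem_of_superset hmem h
  obtain ⟨γ₀, S₀, hl, hS⟩ := IsLoop.exists_limit hr hα isOpen_core hU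
    (mem_of_superset h' fun Y hY => hY.1)
  obtain ⟨γ₀', S₀', hl', hS'⟩ := IsLoop.exists_limit hr hα' isOpen_core hU
    (mem_of_superset h' fun Y hY => hY.2.1)
  refine ⟨γ₀, S₀, γ₀', S₀', hl, hl', tendsto_nhds_unique hS ((hS'.const_mul c).congr' ?_)⟩
  exact mem_of_superset h' fun Y hY => hY.2.2.symm

lemma mem_ball_of_tube (hα : α.IsValid f) {y : EuclideanSpace ℝ (Fin d)} {t : ℝ}
    (ht : t ∈ Icc 0 (2 * α.dur))
    (h : ‖y - (α.center + (t - α.dur) • α.dir)‖ ≤ α.dur * ‖α.dir‖ / 8) :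
    y ∈ Metric.ball α.center (2 * α.dur * ‖α.dir‖) := by
  have h0 : 0 < α.dur * ‖α.dir‖ := mul_pos hα.dur_pos (norm_pos_iff.2 hα.dir_ne)
  rw [mem_ball_iff_norm]
  have h4 : ‖(t - α.dur) • α.dir‖ ≤ α.dur * ‖α.dir‖ := by
    rw [norm_smul, Real.norm_eq_abs]
    gcongr
    rw [abs_le]
    constructor <;> linarith [ht.1, ht.2]
  calc ‖y - α.center‖ = ‖(y - (α.center + (t - α.dur) • α.dir)) + (t - α.dur) • α.dir‖ := by
        congr 1; abel
    _ ≤ α.dur * ‖α.dir‖ / 8 + α.dur * ‖α.dir‖ := (norm_add_le _ _).trans (add_le_add h h4)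
    _ < 2 * α.dur * ‖α.dir‖ := by linarith

/-- A loop records the value 1 only pointwise, as limits require; `vel_fst` needs it on a
neighbourhood, and the validity of the box supplies that. -/
lemma IsValid.eventually_eq_one (hα : α.IsValid f) {x : M} (hx : f α.chart x = 1)
    (hb : coord f α.chart x ∈ Metric.ball α.center (2 * α.dur * ‖α.dir‖)) :
    f α.chart =ᶠ[𝓝 x] 1 := by
  set e := chartAt (EuclideanSpace ℝ (Fin d)) (f.c α.chart) with he
  have hxs : x ∈ e.source := f.mem_chartAt_source_of_eq_one hx
  rw [coord_of_eq_one f hx] at hb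
  filter_upwards [(e.isOpen_inter_preimage Metric.isOpen_ball).mem_nhds ⟨hxs, hb⟩] with y hy
  have := hα.eq_one (e y) (Metric.ball_subset_closedBall hy.2)
  rwa [← he, e.left_inv hy.1] at this

lemma hasDerivAt_coord {γ : ℝ → M} (h : IsCurve (immersion f) (vel f X) γ) (i : κ) (t : ℝ) :
    HasDerivAt (fun t => coord f i (γ t)) (vel f X (γ t) i).1 t :=
  (hasDerivAt_pi.1 (h t) i).fst

end Box

end CrVectorField

/-! ### Empty interior of the bad sets -/

namespace CrVectorField

variable {d r : ℕ} {M : Type*} [TopologicalSpace M]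
  [ChartedSpace (EuclideanSpace ℝ (Fin d)) M] [IsManifold (𝓡 d) ∞ M]
  {κ : Type*} [Fintype κ]
  {f : SmoothBumpCovering κ (𝓡 d) M}

namespace Box

variable {α α' : Box d κ} {A : Set M} {N : ℝ} {X : CrVectorField d r M}

/-- Among the loops of the perturbations of `X`, the strength of the perturbation in a box is a
Lipschitz function of the entrance point and of the return time. -/
lemma IsLoop.exists_norm_sub_le [T2Space M] [CompactSpace M] (hr : 1 ≤ r) (hα : α.IsValid f)
    (hX : α.IsGood f X) {G : Type*} {Z' : G → CrVectorField d r M}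
    (hZ' : ∀ w, ∀ x ∉ A, Z' w x = 0) {β : EuclideanSpace ℝ (Fin d) → ℝ} {C : NNReal}
    (hβ : LipschitzWith C β) (hβ0 : ∀ y, 0 ≤ β y) (hβ1 : ∀ y, β y ≤ 1)
    (hβb : ∀ y ∈ Metric.closedBall α.center (α.dur * ‖α.dir‖ / 4), β y = 1)
    {Z : EuclideanSpace ℝ (Fin d) → CrVectorField d r M}
    (hZ : ∀ w, ∀ x ∈ (chartAt (EuclideanSpace ℝ (Fin d)) (f.c α.chart)).source,
      mfderiv (𝓡 d) (𝓡 d) (chartAt (EuclideanSpace ℝ (Fin d)) (f.c α.chart)) x (Z w x) =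
        β (chartAt (EuclideanSpace ℝ (Fin d)) (f.c α.chart) x) • w)
    (hZ0 : ∀ w, ∀ x ∉ α.core f, Z w x = 0) :
    ∃ K : ℝ, 0 ≤ K ∧ ∀ w₁ w₁' w₂ w₂' γ₁ S₁ γ₂ S₂,
      C * ‖w₁‖ * α.dur ≤ 1 / 100 → C * ‖w₂‖ * α.dur ≤ 1 / 100 →
      α.IsLoop f A N (X + (Z w₁ + Z' w₁')) γ₁ S₁ → α.IsLoop f A N (X + (Z w₂ + Z' w₂')) γ₂ S₂ →
      ‖w₁ - w₂‖ ≤ K * (‖coord f α.chart (γ₁ 0) - coord f α.chart (γ₂ 0)‖ + |S₁ - S₂|) := by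
  obtain ⟨L, hL⟩ := exists_lipschitz_vel f hr X
  obtain ⟨V, hV⟩ := isCompact_univ.exists_bound_of_continuousOn
    (contMDiff_vel f X).continuous.continuousOn
  set e := chartAt (EuclideanSpace ℝ (Fin d)) (f.c α.chart) with he
  obtain ⟨D, hD⟩ := exists_lipschitzOnWith_of_contDiffOn (by simp)
    (contDiffOn_immersion_symm f α.chart) e.open_target
    (isCompact_closedBall α.center (2 * α.dur * ‖α.dir‖)) hα.mem_target
  have hτ := hα.dur_pos
  have velX : ∀ w w' x, x ∉ α.core f → x ∉ A → vel f (X + (Z w + Z' w')) x = vel f X x := by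
    intro w w' x h1 h2
    rw [vel_add, vel_add, vel_of_eq_zero f _ (hZ0 w x h1), vel_of_eq_zero f _ (hZ' w' x h2),
      add_zero, add_zero]
  have velZ : ∀ w w' x, x ∉ A → f α.chart =ᶠ[𝓝 x] 1 →
      (vel f (X + (Z w + Z' w')) x α.chart).1 =
        (vel f X x α.chart).1 + β (coord f α.chart x) • w := by
    intro w w' x h1 h2
    rw [vel_add, vel_add, vel_of_eq_zero f _ (hZ' w' x h1), add_zero, Pi.add_apply, Prod.fst_add,
      vel_fst f (Z w) h2, coord_of_eq_one f h2.self_of_nhds]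
    congr 1
    exact hZ w x (f.mem_chartAt_source_of_eq_one h2.self_of_nhds)
  set B := Real.exp ((L + 1) * N) with hB
  have hBpos : 0 < B := Real.exp_pos _
  -- The backward comparison needs ordered return times; exchanging the two loops covers the other
  -- case.
  have main : ∀ w₁ w₁' w₂ w₂' γ₁ S₁ γ₂ S₂, S₁ ≤ S₂ → C * ‖w₂‖ * α.dur ≤ 1 / 100 →
      α.IsLoop f A N (X + (Z w₁ + Z' w₁')) γ₁ S₁ → α.IsLoop f A N (X + (Z w₂ + Z' w₂')) γ₂ S₂ →
      ‖w₁ - w₂‖ ≤ (20 / α.dur * (D * B + 2 + |V|)) *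
        (‖coord f α.chart (γ₁ 0) - coord f α.chart (γ₂ 0)‖ + |S₁ - S₂|) := by
    intro w₁ w₁' w₂ w₂' γ₁ S₁ γ₂ S₂ hS hw₂ h₁ h₂
    have hder : ∀ w w' γ S, α.IsLoop f A N (X + (Z w + Z' w')) γ S → ∀ t ∈ Icc 0 (2 * α.dur),
        HasDerivAt (fun t => coord f α.chart (γ t))
          ((vel f X (γ t) α.chart).1 + β (coord f α.chart (γ t)) • w) t := by
      intro w w' γ S h t ht
      have h1 := hasDerivAt_coord h.curve α.chart t
      rwa [velZ w w' _ (h.avoid t ⟨ht.1, ht.2.trans h.dur_le⟩)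
        (hα.eventually_eq_one (h.eq_one t ht) (mem_ball_of_tube hα ht (h.tube t ht)))] at h1
    have hball : ∀ w w' γ S, α.IsLoop f A N (X + (Z w + Z' w')) γ S → ∀ t ∈ Icc 0 (2 * α.dur),
        coord f α.chart (γ t) ∈ α.ball := fun w w' γ S h t ht =>
      Metric.ball_subset_closedBall (mem_ball_of_tube hα ht (h.tube t ht))
    have htr := norm_sub_le_of_transit hτ hβ hβ0 hβ1 hβb (hder _ _ _ _ h₁) (hder _ _ _ _ h₂)
      (fun t ht => hX _ _ (h₁.eq_one t ht) (h₂.eq_one t ht) (hball _ _ _ _ h₁ t ht)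
        (hball _ _ _ _ h₂ t ht)) h₁.tube hw₂
    have hout : ∀ w w' γ S, α.IsLoop f A N (X + (Z w + Z' w')) γ S → ∀ t ∈ Icc (2 * α.dur) S,
        HasDerivAt (immersion f ∘ γ) (vel f X (γ t)) t := by
      intro w w' γ S h t ht
      have h1 := h.curve t
      rwa [velX w w' _ (h.avoid_core t ht) (h.avoid t ⟨by linarith [ht.1], ht.2⟩)] at h1
    -- After leaving the box both loops follow the unperturbed `X`, and they end at their entrance
    -- points, so the exit points are controlled by entrance points and return times.
    have hback := norm_sub_le_of_backward hL (fun x => hV x (mem_univ x)) (by positivity)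
      h₁.dur_le hS h₁.le (hout _ _ _ _ h₁) (hout _ _ _ _ h₂)
    rw [h₁.closed, h₂.closed] at hback
    have h0 : (0 : ℝ) ∈ Icc 0 (2 * α.dur) := ⟨le_rfl, by positivity⟩
    have hsymm : ∀ w w' γ S, α.IsLoop f A N (X + (Z w + Z' w')) γ S →
        e.symm (coord f α.chart (γ 0)) = γ 0 := fun w w' γ S h => by
      rw [coord_of_eq_one f (h.eq_one 0 h0)]
      exact e.left_inv (f.mem_chartAt_source_of_eq_one (h.eq_one 0 h0))
    -- At the entrance the ambient distance is bounded by the chart distance, the quantity that the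
    -- hyperplane coordinates measure.
    have hent := hD.dist_le_mul _ (hball _ _ _ _ h₁ 0 h0) _ (hball _ _ _ _ h₂ 0 h0)
    simp only [Function.comp_apply, ← he, hsymm _ _ _ _ h₁, hsymm _ _ _ _ h₂,
      dist_eq_norm] at hent
    have hcoord := norm_coord_sub_le f α.chart (γ₁ (2 * α.dur)) (γ₂ (2 * α.dur))
    set a := ‖coord f α.chart (γ₁ 0) - coord f α.chart (γ₂ 0)‖ with ha
    have ha0 : 0 ≤ a := norm_nonneg _
    have h1 : α.dur / 20 * ‖w₁ - w₂‖ ≤ (D * B + 2 + |V|) * (a + |S₁ - S₂|) := by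
      have h2 : ‖immersion f (γ₁ 0) - immersion f (γ₂ 0)‖ * B ≤ D * a * B := by gcongr
      have h3 : V * |S₁ - S₂| ≤ |V| * |S₁ - S₂| := by gcongr; exact le_abs_self V
      have h4 : 0 ≤ (D * B + 2) * |S₁ - S₂| := by positivity
      have h5 : 0 ≤ |V| * a := by positivity
      nlinarith
    calc ‖w₁ - w₂‖ = 20 / α.dur * (α.dur / 20 * ‖w₁ - w₂‖) := by field_simp
      _ ≤ 20 / α.dur * ((D * B + 2 + |V|) * (a + |S₁ - S₂|)) := by gcongr
      _ = _ := by ring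
  refine ⟨20 / α.dur * (D * B + 2 + |V|), by positivity, ?_⟩
  intro w₁ w₁' w₂ w₂' γ₁ S₁ γ₂ S₂ hw₁ hw₂ h₁ h₂
  rcases le_total S₁ S₂ with h | h
  · exact main _ _ _ _ _ _ _ _ h hw₂ h₁ h₂
  · have := main _ _ _ _ _ _ _ _ h hw₁ h₂ h₁
    rwa [norm_sub_rev, norm_sub_rev (coord f α.chart (γ₂ 0)), abs_sub_comm] at this

/-- The difference is already orthogonal to `v`, so `d - 1` coordinates record entrance points on
one hyperplane without distortion. -/
lemma norm_orthogonalProjection_sub {V : Type*} [NormedAddCommGroup V] [InnerProductSpace ℝ V]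
    {v x y : V} (h : inner ℝ x v = inner ℝ y v) :
    ‖(ℝ ∙ v)ᗮ.orthogonalProjectionOnto x - (ℝ ∙ v)ᗮ.orthogonalProjectionOnto y‖ = ‖x - y‖ := by
  have hmem : x - y ∈ (ℝ ∙ v)ᗮ := by
    rw [Submodule.mem_orthogonal_singleton_iff_inner_left, inner_sub_left, h, sub_self]
  rw [← map_sub]
  change ‖(((ℝ ∙ v)ᗮ.orthogonalProjectionOnto (x - y) : (ℝ ∙ v)ᗮ) : V)‖ = _
  congr 1
  exact Submodule.starProjection_eq_self_iff.2 hmem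

lemma interior_bad [T2Space M] [CompactSpace M] (hr : 1 ≤ r) (hα : α.IsValid f)
    (hα' : α'.IsValid f) (c : ℝ) (N : ℝ) :
    interior (bad f α α' c N : Set (CrVectorField d r M)) = ∅ := by
  by_contra hne
  obtain ⟨X, hX⟩ := nonempty_iff_ne_empty.2 hne
  -- This radius is that of the core, so the push vanishes off it; the bump is 1 on half the radius,
  -- as the crossing estimate requires.
  have bump : ∀ α : Box d κ, α.IsValid f → _ := fun α hα =>
    exists_bump_field (r := r) (p := f.c α.chart) (b := α.center) (ρ := α.dur * ‖α.dir‖ / 2)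
      (by have := hα.dur_pos; have := norm_pos_iff.2 hα.dir_ne; positivity)
      fun y hy => hα.mem_target y (Metric.closedBall_subset_closedBall (by
        have := hα.dur_pos; have := norm_pos_iff.2 hα.dir_ne; nlinarith) hy)
  obtain ⟨β, C, Z, hβ, hβ0, hβ1, hβb, hZ, hZ0⟩ := bump α hα
  obtain ⟨β', C', Z', hβ', hβ0', hβ1', hβb', hZ', hZ0'⟩ := bump α' hα'
  rw [show α.dur * ‖α.dir‖ / 2 / 2 = α.dur * ‖α.dir‖ / 4 by ring] at hβb
  rw [show α'.dur * ‖α'.dir‖ / 2 / 2 = α'.dur * ‖α'.dir‖ / 4 by ring] at hβb'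
  obtain ⟨hg, hg', -⟩ := interior_subset hX
  obtain ⟨K, hK0, hK⟩ := IsLoop.exists_norm_sub_le (N := N) hr hα hg (A := α'.core f) hZ0' hβ hβ0
    hβ1 hβb hZ hZ0
  obtain ⟨K', hK0', hK'⟩ := IsLoop.exists_norm_sub_le (N := N) hr hα' hg' (A := α.core f) hZ0 hβ'
    hβ0' hβ1' hβb' hZ' hZ0'
  let E := EuclideanSpace ℝ (Fin d)
  let L : (E × E) →ₗ[ℝ] CrVectorField d r M := Z.coprod Z'
  let s : Set (E × E) := {g | X + L g ∈ bad f α α' c N ∧ C * ‖g.1‖ * α.dur ≤ 1 / 100 ∧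
    C' * ‖g.2‖ * α'.dur ≤ 1 / 100}
  have hs : s ∈ 𝓝 (0 : E × E) := by
    have h1 : ∀ᶠ g in 𝓝 (0 : E × E), X + L g ∈ bad f α α' c N :=
      (tendsto_add_linear X L).eventually (mem_interior_iff_mem_nhds.1 hX)
    have h2 : ∀ᶠ g in 𝓝 (0 : E × E), C * ‖g.1‖ * α.dur < 1 / 100 :=
      (Continuous.tendsto (f := fun g : E × E => C * ‖g.1‖ * α.dur) (by fun_prop)
        0).eventually_lt_const (by simp)
    have h3 : ∀ᶠ g in 𝓝 (0 : E × E), C' * ‖g.2‖ * α'.dur < 1 / 100 :=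
      (Continuous.tendsto (f := fun g : E × E => C' * ‖g.2‖ * α'.dur) (by fun_prop)
        0).eventually_lt_const (by simp)
    filter_upwards [h1, h2, h3] with g h1 h2 h3 using ⟨h1, h2.le, h3.le⟩
  have hchoice : ∀ g : E × E, ∃ γ S γ' S', g ∈ s →
      α.IsLoop f (α'.core f) N (X + L g) γ S ∧ α'.IsLoop f (α.core f) N (X + L g) γ' S' ∧
        S = c * S' := by
    intro g
    obtain ⟨-, -, γ₀, -⟩ := interior_subset hX
    by_cases h : g ∈ s
    · obtain ⟨⟨-, -, γ, S, γ', S', h⟩, -⟩ := h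
      exact ⟨γ, S, γ', S', fun _ => h⟩
    -- Off `s` the choice is irrelevant, but some curve in `M` is needed; one comes from `X` itself.
    · exact ⟨γ₀, 0, γ₀, 0, fun h' => absurd h' h⟩
  choose γ S γ' S' hl using hchoice
  have hd : d ≠ 0 := by
    rintro rfl
    exact hα.dir_ne (Subsingleton.elim _ _)
  obtain ⟨n, rfl⟩ := Nat.exists_eq_succ_of_ne_zero hd
  have : Fact (Module.finrank ℝ E = n + 1) := ⟨finrank_euclideanSpace_fin⟩
  -- `S` is omitted because it equals `c * S'`; this saves the one dimension that decides the count.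
  let φ : E × E → (ℝ ∙ α.dir)ᗮ × (ℝ ∙ α'.dir)ᗮ × ℝ := fun g =>
    ((ℝ ∙ α.dir)ᗮ.orthogonalProjectionOnto (coord f α.chart (γ g 0)),
      (ℝ ∙ α'.dir)ᗮ.orthogonalProjectionOnto (coord f α'.chart (γ' g 0)), S' g)
  have hdim : Module.finrank ℝ ((ℝ ∙ α.dir)ᗮ × (ℝ ∙ α'.dir)ᗮ × ℝ) < Module.finrank ℝ (E × E) := by
    have h1 : Module.finrank ℝ (ℝ ∙ α.dir)ᗮ = n :=
      Submodule.finrank_orthogonal_span_singleton hα.dir_ne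
    have h2 : Module.finrank ℝ (ℝ ∙ α'.dir)ᗮ = n :=
      Submodule.finrank_orthogonal_span_singleton hα'.dir_ne
    have h3 : Module.finrank ℝ E = n + 1 := finrank_euclideanSpace_fin
    simp only [Module.finrank_prod, Module.finrank_self, h1, h2, h3]
    omega
  have hint := interior_eq_empty_of_antilipschitz hdim φ
    (s := s) ⟨K * (1 + |c|) + K' * 2, by positivity⟩ (by
      intro g hgs g' hgs'
      obtain ⟨hl₁, hl₁', hS₁⟩ := hl g hgs
      obtain ⟨hl₂, hl₂', hS₂⟩ := hl g' hgs'
      have e1 : ‖φ g - φ g'‖ ≥ ‖coord f α.chart (γ g 0) - coord f α.chart (γ g' 0)‖ := by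
        rw [← norm_orthogonalProjection_sub (v := α.dir) (hl₁.level.trans hl₂.level.symm)]
        exact norm_fst_le (φ g - φ g')
      have e2 : ‖φ g - φ g'‖ ≥ ‖coord f α'.chart (γ' g 0) - coord f α'.chart (γ' g' 0)‖ := by
        rw [← norm_orthogonalProjection_sub (v := α'.dir) (hl₁'.level.trans hl₂'.level.symm)]
        exact (norm_fst_le (φ g - φ g').2).trans (norm_snd_le _)
      have e3 : ‖φ g - φ g'‖ ≥ |S' g - S' g'| :=
        (norm_snd_le (φ g - φ g').2).trans (norm_snd_le _)
      have hL : ∀ g : E × E, L g = Z g.1 + Z' g.2 := fun g => rfl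
      have b1 := hK g.1 g.2 g'.1 g'.2 _ _ _ _ hgs.2.1 hgs'.2.1 hl₁ hl₂
      have b2 := hK' g.2 g.1 g'.2 g'.1 (γ' g) (S' g) (γ' g') (S' g') hgs.2.2 hgs'.2.2
        (by rwa [add_comm (Z' g.2)]) (by rwa [add_comm (Z' g'.2)])
      rw [hS₁, hS₂, ← mul_sub, abs_mul] at b1
      have b3 : ‖g.1 - g'.1‖ ≤ K * (1 + |c|) * ‖φ g - φ g'‖ := by
        refine b1.trans ?_
        rw [mul_assoc]
        refine mul_le_mul_of_nonneg_left ?_ hK0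
        nlinarith [abs_nonneg c]
      have b4 : ‖g.2 - g'.2‖ ≤ K' * 2 * ‖φ g - φ g'‖ := by
        refine b2.trans ?_
        rw [mul_assoc]
        exact mul_le_mul_of_nonneg_left (by linarith) hK0'
      change max ‖g.1 - g'.1‖ ‖g.2 - g'.2‖ ≤ (K * (1 + |c|) + K' * 2) * ‖φ g - φ g'‖
      have := norm_nonneg (φ g - φ g')
      refine max_le (b3.trans ?_) (b4.trans ?_)
      · have : 0 ≤ K' * 2 * ‖φ g - φ g'‖ := by positivity
        linarith
      · have : 0 ≤ K * (1 + |c|) * ‖φ g - φ g'‖ := by positivity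
        linarith)
  exact (hint ▸ mem_interior_iff_mem_nhds.2 hs : (0 : E × E) ∈ (∅ : Set (E × E)))

end Box

end CrVectorField

/-! ### From closed orbits to boxes, and the Baire argument -/

namespace CrVectorField

variable {d r : ℕ} {M : Type*} [TopologicalSpace M]
  [ChartedSpace (EuclideanSpace ℝ (Fin d)) M] [IsManifold (𝓡 d) ∞ M]
  {κ : Type*} [Fintype κ]

lemma contMDiff_one (hr : 1 ≤ r) (X : CrVectorField d r M) :
    ContMDiff (𝓡 d) ((𝓡 d).prod 𝓘(ℝ, EuclideanSpace ℝ (Fin d))) 1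
      (fun x => (⟨x, X x⟩ : TangentBundle (𝓡 d) M)) :=
  X.contMDiff.of_le (by exact_mod_cast hr)

lemma isCurve_of_isMIntegralCurve [T2Space M] (f : SmoothBumpCovering κ (𝓡 d) M)
    {X : CrVectorField d r M} {γ : ℝ → M} (h : IsMIntegralCurve γ X) :
    IsCurve (immersion f) (vel f X) γ := by
  intro t
  let L : ℝ →L[ℝ] (κ → EuclideanSpace ℝ (Fin d) × ℝ) :=
    (mfderiv (𝓡 d) 𝓘(ℝ, κ → EuclideanSpace ℝ (Fin d) × ℝ) (immersion f) (γ t)).comp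
      (ContinuousLinearMap.smulRight (1 : ℝ →L[ℝ] ℝ) (X (γ t)))
  have h1 : HasFDerivAt (immersion f ∘ γ) L t := hasMFDerivAt_iff_hasFDerivAt.1
    (((contMDiff_immersion f).mdifferentiableAt (x := γ t) (by simp)).hasMFDerivAt.comp t (h t))
  have h2 : L 1 = vel f X (γ t) :=
    congrArg (mfderiv (𝓡 d) 𝓘(ℝ, κ → EuclideanSpace ℝ (Fin d) × ℝ) (immersion f) (γ t))
      (one_smul ℝ (X (γ t)))
  exact h2 ▸ h1.hasDerivAt

/-- If the field vanished at one point of the curve, uniqueness would identify the curve with the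
constant solution. -/
lemma ne_zero_of_nonconstant [T2Space M] (hr : 1 ≤ r) {X : CrVectorField d r M} {γ : ℝ → M}
    (hγ : IsMIntegralCurve γ X) (hne : ∃ s t, γ s ≠ γ t) (t₀ : ℝ) : X (γ t₀) ≠ 0 := by
  intro h0
  have hconst : γ = fun _ => γ t₀ :=
    isMIntegralCurve_Ioo_eq_of_contMDiff_boundaryless (t₀ := t₀) (contMDiff_one hr X) hγ
      (isMIntegralCurve_const h0) rfl
  obtain ⟨s, t, hst⟩ := hne
  exact hst ((congrFun hconst s).trans (congrFun hconst t).symm)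

/-- The boxes with parameters in a countable dense set. -/
def Box.ofIndex (j : κ × ℕ × ℕ × ℚ × ℕ) : Box d κ where
  chart := j.1
  dir := TopologicalSpace.denseSeq _ j.2.1
  center := TopologicalSpace.denseSeq _ j.2.2.1
  level := j.2.2.2.1
  dur := 1 / ((j.2.2.2.2 : ℝ) + 1)

lemma exists_denseSeq_near (y : EuclideanSpace ℝ (Fin d)) {ε : ℝ} (hε : 0 < ε) :
    ∃ k, ‖TopologicalSpace.denseSeq (EuclideanSpace ℝ (Fin d)) k - y‖ < ε := by
  obtain ⟨k, hk⟩ := (TopologicalSpace.denseRange_denseSeq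
    (EuclideanSpace ℝ (Fin d))).exists_dist_lt y hε
  exact ⟨k, by rwa [dist_comm, dist_eq_norm] at hk⟩

set_option maxHeartbeats 800000 in
/-- A nonconstant periodic curve of minimal period `S` enters a box with parameters in the countable
dense set, and loops through it with return time `S`. -/
lemma exists_box [T2Space M] [CompactSpace M] (hr : 1 ≤ r) (f : SmoothBumpCovering κ (𝓡 d) M)
    {X : CrVectorField d r M} {γ : ℝ → M} (hγ : IsMIntegralCurve γ X)
    (hne : ∃ s t, γ s ≠ γ t) {S : ℝ} (hS : 0 < S) (hper : Function.Periodic γ S)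
    (hmin : ∀ T, 0 < T → Function.Periodic γ T → S ≤ T) {A : Set M} (hA : IsClosed A)
    (hγA : ∀ t, γ t ∉ A) :
    ∃ (j : κ × ℕ × ℕ × ℚ × ℕ) (t₀ : ℝ), (Box.ofIndex j).IsValid f ∧
      (Box.ofIndex j).IsGood f X ∧ (∀ x ∈ (Box.ofIndex j).core f, x ∉ A) ∧
      ∀ (A' : Set M) (N : ℝ), (∀ t, γ t ∉ A') → S ≤ N →
        (Box.ofIndex j).IsLoop f A' N X (fun t => γ (t + t₀)) S := by
  have hcurve := isCurve_of_isMIntegralCurve f hγ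
  have hcont : Continuous γ := hγ.continuous
  set x₀ := γ 0 with hx₀
  set i := f.ind x₀ (mem_univ x₀)
  set e := chartAt (EuclideanSpace ℝ (Fin d)) (f.c i) with he
  have hx₀s : x₀ ∈ e.source := f.mem_chartAt_ind_source x₀ (mem_univ x₀)
  have hev : f i =ᶠ[𝓝 x₀] 1 := f.eventuallyEq_one x₀ (mem_univ x₀)
  set p : ℝ → EuclideanSpace ℝ (Fin d) := fun t => coord f i (γ t) with hp
  set p' : ℝ → EuclideanSpace ℝ (Fin d) := fun t => (vel f X (γ t) i).1 with hp'
  have hpd : ∀ t, HasDerivAt p (p' t) t := Box.hasDerivAt_coord hcurve i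
  have hpc : Continuous p := (continuous_coord f i).comp hcont
  have hp'c : Continuous p' :=
    continuous_fst.comp ((continuous_apply i).comp ((contMDiff_vel f X).continuous.comp hcont))
  have hpe : ∀ t, f i (γ t) = 1 → e (γ t) = p t := fun t ht => (coord_of_eq_one f ht).symm
  have hone : f i x₀ = 1 := hev.self_of_nhds
  set y₀ := p 0 with hy₀
  have hy₀e : e x₀ = y₀ := hpe 0 hone
  set v₀ := p' 0 with hv₀
  have hv₀ne : v₀ ≠ 0 := by
    intro h0
    have h1 := vel_fst f X hev
    have hinj := (mdifferentiable_chart (I := 𝓡 d) (f.c i)).mfderiv_injective hx₀s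
    refine ne_zero_of_nonconstant hr hγ hne 0 (hinj ?_)
    rw [map_zero]
    exact h1.symm.trans h0
  set n₀ := ‖v₀‖ with hn₀
  have hn₀pos : 0 < n₀ := norm_pos_iff.2 hv₀ne
  -- a time during which the curve is almost straight
  obtain ⟨δ, hδ, hδ1, hδ2⟩ : ∃ δ > 0, (∀ t, |t| ≤ δ → f i (γ t) = 1) ∧
      ∀ t, |t| ≤ δ → ‖p' t - v₀‖ ≤ n₀ / 100 := by
    have h1 : ∀ᶠ t in 𝓝 (0 : ℝ), f i (γ t) = 1 := (hcont.tendsto 0).eventually hev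
    have h2 : ∀ᶠ t in 𝓝 (0 : ℝ), ‖p' t - v₀‖ < n₀ / 100 :=
      ((hp'c.sub continuous_const).norm.tendsto 0).eventually_lt_const
        (by
          change ‖p' 0 - v₀‖ < n₀ / 100
          rw [hv₀, sub_self, norm_zero]
          positivity)
    obtain ⟨δ, hδ, h⟩ := Metric.nhds_basis_closedBall.eventually_iff.1 (h1.and h2)
    refine ⟨δ, hδ, fun t ht => (h ?_).1, fun t ht => (h ?_).2.le⟩ <;> simpa using ht
  have hline : ∀ w, |w| ≤ δ → ‖p w - (y₀ + w • v₀)‖ ≤ n₀ / 100 * |w| := by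
    intro w hw
    have h1 := (convex_Icc (-δ) δ).norm_image_sub_le_of_norm_hasDerivWithin_le
      (f := fun t => p t - t • v₀) (f' := fun t => p' t - v₀) (C := n₀ / 100)
      (fun t _ => by
        simpa [Pi.sub_def] using ((hpd t).sub ((hasDerivAt_id t).smul_const v₀)).hasDerivWithinAt)
      (fun t ht => hδ2 t (abs_le.2 ht)) (x := 0) (y := w) ⟨by linarith, hδ.le⟩ (abs_le.1 hw)
    simp only [zero_smul, sub_zero, Real.norm_eq_abs] at h1
    rwa [show p w - (y₀ + w • v₀) = p w - w • v₀ - p 0 by rw [hy₀]; abel]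
  -- a ball where the curve is met only around time `0`
  obtain ⟨R, hR, hRt⟩ : ∃ R > 0, ∀ y ∈ Metric.closedBall y₀ R, y ∈ e.target ∧
      f i (e.symm y) = 1 ∧ e.symm y ∉ A ∧ e.symm y ∉ γ '' Icc δ (S - δ) := by
    have hcl : IsClosed (γ '' Icc δ (S - δ)) := (isCompact_Icc.image hcont).isClosed
    -- A return to `x₀` at such a time would be a positive period smaller than `S`.
    have hnm : x₀ ∉ γ '' Icc δ (S - δ) := by
      rintro ⟨t, ht, hteq⟩
      have h1 := hγ.periodic_of_eq (contMDiff_one hr X) hteq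
      rw [sub_zero] at h1
      linarith [hmin t (by linarith [ht.1]) h1, ht.2]
    have h1 : ∀ᶠ x in 𝓝 x₀, f i x = 1 ∧ x ∉ A ∧ x ∉ γ '' Icc δ (S - δ) :=
      hev.and ((hA.isOpen_compl.eventually_mem (hγA 0)).and
        (hcl.isOpen_compl.eventually_mem hnm))
    have hyt : y₀ ∈ e.target := hy₀e ▸ e.map_source hx₀s
    have h2 : Tendsto e.symm (𝓝 y₀) (𝓝 x₀) := by
      have := (e.continuousAt_symm hyt).tendsto
      rwa [← hy₀e, e.left_inv hx₀s, hy₀e] at this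
    obtain ⟨R, hR, h⟩ := Metric.nhds_basis_closedBall.eventually_iff.1
      ((e.open_target.eventually_mem hyt).and (h2.eventually h1))
    exact ⟨R, hR, fun y hy => h hy⟩
  obtain ⟨K, hK⟩ := exists_lipschitz_vel f hr X
  obtain ⟨D, hD⟩ := exists_lipschitzOnWith_of_contDiffOn (by simp)
    (contDiffOn_immersion_symm f i) e.open_target (isCompact_closedBall y₀ R)
    (fun y hy => (hRt y hy).1)
  -- The direction comes before the duration, whose bounds involve `‖v‖`; the center comes last,
  -- with an error measured against `τ * ‖v‖`.
  obtain ⟨k, hk⟩ := exists_denseSeq_near v₀ (ε := n₀ / 100) (by positivity)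
  set v := TopologicalSpace.denseSeq (EuclideanSpace ℝ (Fin d)) k with hv
  set n := ‖v‖ with hn
  have hn1 : n ≤ 101 / 100 * n₀ := by
    linarith [norm_le_norm_add_norm_sub' v v₀]
  have hn2 : n₀ ≤ 102 / 100 * n := by
    have h1 := norm_le_norm_add_norm_sub' v₀ v
    rw [norm_sub_rev] at h1
    linarith
  have hnpos : 0 < n := by linarith
  -- The four bounds keep the box in the ball of radius `R`, make the field vary slowly, keep the
  -- crossing within the straight time `δ`, and leave room for it in one period.
  obtain ⟨m, hm⟩ := exists_nat_one_div_lt (K := ℝ)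
    (show 0 < min (min (R / (4 * n)) (1 / (100 * (K * D + 1)))) (min (δ / 3) (S / 3)) by
      positivity)
  set τ : ℝ := 1 / ((m : ℝ) + 1) with hτ
  have hτpos : 0 < τ := by positivity
  rw [lt_min_iff, lt_min_iff, lt_min_iff] at hm
  obtain ⟨⟨hτR, hτL⟩, hτδ, hτS⟩ := hm
  rw [lt_div_iff₀ (by positivity)] at hτR hτL
  have hτn : 0 < τ * n := by positivity
  obtain ⟨l, hl⟩ := exists_denseSeq_near (y₀ + τ • v) (ε := τ * n / 100) (by positivity)
  set b := TopologicalSpace.denseSeq (EuclideanSpace ℝ (Fin d)) l with hb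
  have key : ∀ w, |w| ≤ δ → ‖p w - (b + (w - τ) • v)‖ ≤ 204 / 10000 * |w| * n + τ * n / 100 := by
    intro w hw
    have h1 : p w - (b + (w - τ) • v) =
        (p w - (y₀ + w • v₀)) + w • (v₀ - v) + (y₀ + τ • v - b) := by module
    have h2 : ‖w • (v₀ - v)‖ ≤ |w| * (n₀ / 100) := by
      rw [norm_smul, Real.norm_eq_abs, norm_sub_rev]
      gcongr
    have h3 := hline w hw
    rw [norm_sub_rev] at hl
    rw [h1]
    refine norm_add₃_le.trans ?_
    have h4 : |w| * n₀ ≤ |w| * (102 / 100 * n) := by gcongr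
    linarith
  -- The component along `v` strictly increases from time `0` to `τ / 100`, so it takes a rational
  -- value in between; starting there makes the level countable data.
  obtain ⟨t₀, ⟨ht₀, ht₀'⟩, q, hq⟩ : ∃ t₀ ∈ Icc 0 (τ / 100), ∃ q : ℚ, inner ℝ (p t₀) v = q := by
    have h1 : inner ℝ (p 0) v < inner ℝ (p (τ / 100)) v := by
      have h2 := hline (τ / 100) (by rw [abs_of_nonneg (by positivity)]; linarith)
      rw [abs_of_nonneg (by positivity)] at h2
      set z := p (τ / 100) - (y₀ + (τ / 100) • v₀) with hz
      have h3 : inner ℝ (p (τ / 100)) v - inner ℝ (p 0) v =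
          τ / 100 * (n₀ ^ 2 + inner ℝ v₀ (v - v₀)) + inner ℝ z v := by
        rw [hz, ← hy₀]
        simp only [inner_sub_left, inner_add_left, inner_sub_right, real_inner_smul_left,
          real_inner_self_eq_norm_sq]
        ring
      have h4 := neg_le_of_abs_le (abs_real_inner_le_norm v₀ (v - v₀))
      have h5 := neg_le_of_abs_le (abs_real_inner_le_norm z v)
      have h6 : ‖v₀‖ * ‖v - v₀‖ ≤ n₀ * (n₀ / 100) := by gcongr
      have h7 : ‖z‖ * ‖v‖ ≤ n₀ / 100 * (τ / 100) * (101 / 100 * n₀) := by gcongr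
      have h8 : 0 < τ * n₀ ^ 2 := by positivity
      have h9 : τ / 100 * (n₀ ^ 2 - n₀ * (n₀ / 100)) ≤
          τ / 100 * (n₀ ^ 2 + inner ℝ v₀ (v - v₀)) := by gcongr; linarith
      nlinarith
    obtain ⟨q, hq1, hq2⟩ := exists_rat_btwn h1
    obtain ⟨t₀, ht₀, h⟩ := intermediate_value_Icc (f := fun t => inner ℝ (p t) v)
      (show (0 : ℝ) ≤ τ / 100 by positivity) (by fun_prop) ⟨hq1.le, hq2.le⟩
    exact ⟨t₀, ht₀, q, h⟩
  have hball : ∀ y ∈ Metric.closedBall b (2 * τ * n), y ∈ Metric.closedBall y₀ R := by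
    intro y hy
    rw [mem_closedBall_iff_norm] at hy ⊢
    have h1 : ‖τ • v‖ = τ * n := by rw [norm_smul, Real.norm_of_nonneg hτpos.le]
    calc ‖y - y₀‖ = ‖(y - b) + (b - (y₀ + τ • v)) + τ • v‖ := by congr 1; abel
      _ ≤ 2 * τ * n + τ * n / 100 + τ * n := norm_add₃_le.trans (by gcongr; exact h1.le)
      _ ≤ R := by linarith
  have hcore : ∀ x, x ∈ e.source → e x ∈ Metric.ball b (τ * n / 2) →
      x ∉ A ∧ x ∉ γ '' Icc δ (S - δ) := by
    intro x hx hxb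
    have h1 := hRt (e x) (hball _ (Metric.closedBall_subset_closedBall (by linarith)
      (Metric.ball_subset_closedBall hxb)))
    rw [e.left_inv hx] at h1
    exact h1.2.2
  have hfar : ∀ w, |w| ≤ δ → 3 / 5 * (τ * n) ≤ |w - τ| * n - 204 / 10000 * |w| * n →
      ¬(γ w ∈ e.source ∧ e (γ w) ∈ Metric.ball b (τ * n / 2)) := by
    rintro w hw h ⟨-, hwb⟩
    rw [hpe w (hδ1 w hw), mem_ball_iff_norm] at hwb
    have h1 := key w hw
    have h2 : |w - τ| * n = ‖(p w - b) - (p w - (b + (w - τ) • v))‖ := by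
      rw [hn, ← Real.norm_eq_abs, ← norm_smul]
      congr 1
      abel
    have h3 := norm_sub_le (p w - b) (p w - (b + (w - τ) • v))
    linarith
  refine ⟨(i, k, l, q, m), t₀, ⟨hτpos, norm_pos_iff.1 hnpos,
    fun y hy => (hRt y (hball y hy)).1, fun y hy => (hRt y (hball y hy)).2.1⟩, ?_,
    fun x hx => (hcore x hx.1 hx.2).1, ?_⟩
  · intro x y hx hy hxb hyb
    change ‖(vel f X x i).1 - (vel f X y i).1‖ ≤ 1 / (100 * τ) * ‖coord f i x - coord f i y‖
    change f i x = 1 at hx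
    change f i y = 1 at hy
    have h1 := hD.dist_le_mul _ (hball _ hxb) _ (hball _ hyb)
    change dist (immersion f (e.symm (coord f i x))) (immersion f (e.symm (coord f i y))) ≤
      D * dist (coord f i x) (coord f i y) at h1
    have hsymm : ∀ x, f i x = 1 → e.symm (coord f i x) = x := fun x hx => by
      rw [coord_of_eq_one f hx]
      exact e.left_inv (f.mem_chartAt_source_of_eq_one hx)
    rw [hsymm x hx, hsymm y hy, dist_eq_norm, dist_eq_norm] at h1
    calc _ ≤ ‖vel f X x - vel f X y‖ := norm_vel_fst_sub_le f X i x y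
      _ ≤ K * ‖immersion f x - immersion f y‖ := hK x y
      _ ≤ K * (D * ‖coord f i x - coord f i y‖) := by gcongr
      _ = (K * D) * ‖coord f i x - coord f i y‖ := by ring
      _ ≤ 1 / (100 * τ) * ‖coord f i x - coord f i y‖ := by
        gcongr
        rw [le_div_iff₀ (by positivity)]
        linarith
  · intro A' N hA' hN
    refine ⟨hcurve.comp_add t₀, ?_, hN, ?_, ?_, ?_, ?_, ?_, fun t _ => hA' _⟩
    · change 2 * τ ≤ S
      linarith
    · rw [add_comm S, hper, zero_add]
    · change inner ℝ (p (0 + t₀)) v = (q : ℝ)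
      rw [zero_add, hq]
    · intro t ht
      change t ∈ Icc 0 (2 * τ) at ht
      exact hδ1 _ (abs_le.2 ⟨by linarith [ht.1], by linarith [ht.2]⟩)
    · intro t ht
      change t ∈ Icc 0 (2 * τ) at ht
      change ‖p (t + t₀) - (b + (t - τ) • v)‖ ≤ τ * n / 8
      have hw : 0 ≤ t + t₀ := by linarith [ht.1]
      have h1 := key (t + t₀) (by rw [abs_of_nonneg hw]; linarith [ht.2])
      rw [abs_of_nonneg hw] at h1
      have h2 : ‖t₀ • v‖ ≤ τ / 100 * n := by
        rw [norm_smul, Real.norm_of_nonneg ht₀]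
        gcongr
      have h3 : (t + t₀) * n ≤ (201 / 100 * τ) * n := by gcongr; linarith [ht.2]
      calc ‖p (t + t₀) - (b + (t - τ) • v)‖
          = ‖(p (t + t₀) - (b + (t + t₀ - τ) • v)) + t₀ • v‖ := by congr 1; module
        _ ≤ 204 / 10000 * (t + t₀) * n + τ * n / 100 + τ / 100 * n :=
          (norm_add_le _ _).trans (add_le_add h1 h2)
        _ ≤ τ * n / 8 := by linarith
    · intro t ht hc
      change t ∈ Icc (2 * τ) S at ht
      set u := t + t₀ with hu
      change γ u ∈ e.source ∧ e (γ u) ∈ Metric.ball b (τ * n / 2) at hc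
      have hu1 : 2 * τ ≤ u := by linarith [ht.1]
      -- Just after the crossing, straightness excludes the core; in mid-period, the choice of `R`
      -- does; near the end, `u - S` is a time near `0`, at most `τ / 100`, before the core is
      -- reached.
      rcases le_or_gt u δ with h1 | h1
      · refine hfar u (by rwa [abs_of_nonneg (by linarith)]) ?_ hc
        rw [abs_of_nonneg (show 0 ≤ u - τ by linarith), abs_of_nonneg (show 0 ≤ u by linarith)]
        have := mul_le_mul_of_nonneg_right hu1 hnpos.le
        linarith
      · rcases le_or_gt u (S - δ) with h2 | h2
        · exact (hcore _ hc.1 hc.2).2 ⟨u, ⟨h1.le, h2⟩, rfl⟩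
        · have hw1 : u - S ≤ τ / 100 := by linarith [ht.2]
          rw [← hper.sub_eq u] at hc
          refine hfar (u - S) (abs_le.2 ⟨by linarith, by linarith⟩) ?_ hc
          rw [abs_of_nonpos (show u - S - τ ≤ 0 by linarith)]
          rcases le_total 0 (u - S) with h3 | h3
          · rw [abs_of_nonneg h3]
            have := mul_le_mul_of_nonneg_right hw1 hnpos.le
            linarith
          · rw [abs_of_nonpos h3]
            have := mul_nonpos_of_nonpos_of_nonneg h3 hnpos.le
            linarith

lemma IsClosedOrbit.exists_curve [T2Space M] (hr : 1 ≤ r) {X : CrVectorField d r M} {O : Set M}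
    (hO : X.IsClosedOrbit O) : ∃ γ : ℝ → M, IsMIntegralCurve γ X ∧ range γ = O ∧
      (∃ s t, γ s ≠ γ t) ∧ 0 < X.period O ∧ Function.Periodic γ (X.period O) ∧
      ∀ T, 0 < T → Function.Periodic γ T → X.period O ≤ T := by
  obtain ⟨⟨hpos, γ, hγ, hrange, hper⟩, hleast⟩ := isLeast_period hr hO
  refine ⟨γ, hγ, hrange, ?_, hpos, hper, fun T hT hT' => hleast ⟨hT, γ, hγ, hrange, hT'⟩⟩
  obtain ⟨δ, -, -, ⟨s, t, hst⟩, hδ⟩ := hO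
  obtain ⟨s', hs'⟩ : δ s ∈ range γ := by rw [hrange, ← hδ]; exact mem_range_self s
  obtain ⟨t', ht'⟩ : δ t ∈ range γ := by rw [hrange, ← hδ]; exact mem_range_self t
  exact ⟨s', t', by rwa [hs', ht']⟩

lemma range_eq_of_mem [T2Space M] (hr : 1 ≤ r) {X : CrVectorField d r M} {γ γ' : ℝ → M}
    (hγ : IsMIntegralCurve γ X) (hγ' : IsMIntegralCurve γ' X) {a b : ℝ} (h : γ a = γ' b) :
    range γ = range γ' := by
  have h1 : γ ∘ (· + a) = γ' ∘ (· + b) :=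
    isMIntegralCurve_Ioo_eq_of_contMDiff_boundaryless (t₀ := 0) (contMDiff_one hr X)
      (hγ.comp_add a) (hγ'.comp_add b) (by simpa using h)
  rw [← (add_right_surjective a).range_comp γ, h1, (add_right_surjective b).range_comp γ']

lemma isClosed_range_of_periodic [T2Space M] {γ : ℝ → M} (hγ : Continuous γ) {S : ℝ} (hS : 0 < S)
    (hper : Function.Periodic γ S) : IsClosed (range γ) := by
  rw [← hper.image_Icc hS 0]
  exact (isCompact_Icc.image hγ).isClosed

/-- For a residual set of vector fields, the ratio of the periods of two distinct closed orbits is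
irrational. -/
theorem exists_residual_irrational_period [T2Space M] [CompactSpace M] (hr : 1 ≤ r) :
    ∃ R₁ ∈ residual (CrVectorField d r M), ∀ X ∈ R₁, ∀ O O' : Set M,
      X.IsClosedOrbit O → X.IsClosedOrbit O' → O ≠ O' →
        Irrational (X.period O / X.period O') := by
  obtain ⟨κ, f, -⟩ := SmoothBumpCovering.exists_isSubordinate (𝓡 d) (M := M) isClosed_univ
    fun x _ => univ_mem
  have hκ : Fintype κ := f.fintype
  refine ⟨⋂ k : (κ × ℕ × ℕ × ℚ × ℕ) × (κ × ℕ × ℕ × ℚ × ℕ) × ℚ × ℕ,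
    {X | (Box.ofIndex k.1).IsValid f → (Box.ofIndex k.2.1).IsValid f →
      X ∉ Box.bad f (Box.ofIndex k.1) (Box.ofIndex k.2.1) k.2.2.1 k.2.2.2}, ?_, ?_⟩
  · rw [countable_iInter_mem]
    rintro ⟨j, j', c, N⟩
    by_cases hj : (Box.ofIndex j : Box d κ).IsValid f
    · by_cases hj' : (Box.ofIndex j' : Box d κ).IsValid f
      · have hcl := Box.isClosed_bad (f := f) (M := M) hr hj.dur_pos.le hj'.dur_pos.le c N
        refine mem_of_superset (residual_of_dense_open hcl.isOpen_compl
          (interior_eq_empty_iff_dense_compl.1 (Box.interior_bad hr hj hj' c N))) ?_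
        exact fun X hX _ _ => hX
      · exact univ_mem' fun X _ h => absurd h hj'
    · exact univ_mem' fun X h => absurd h hj
  · intro X hX O O' hO hO' hne
    obtain ⟨γ, hγ, hrange, hnc, hpos, hper, hmin⟩ := hO.exists_curve hr
    obtain ⟨γ', hγ', hrange', hnc', hpos', hper', hmin'⟩ := hO'.exists_curve hr
    have hdisj : ∀ s t, γ s ≠ γ' t := fun s t h =>
      hne (by rw [← hrange, ← hrange', range_eq_of_mem hr hγ hγ' h])
    -- Each box avoids the whole of the other orbit. As `A'` stays free in `exists_box`, both boxes
    -- can be chosen before each loop is required to miss the other core.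
    obtain ⟨j, t₀, hval, hgood, hcore, hloop⟩ := exists_box hr f hγ hnc hpos hper hmin
      (isClosed_range_of_periodic hγ'.continuous hpos' hper') (by
        rintro t ⟨s, hs⟩
        exact hdisj t s hs.symm)
    obtain ⟨j', t₀', hval', hgood', hcore', hloop'⟩ := exists_box hr f hγ' hnc' hpos' hper' hmin'
      (isClosed_range_of_periodic hγ.continuous hpos hper) (by
        rintro t ⟨s, hs⟩
        exact hdisj s t hs)
    rintro ⟨c, hc⟩
    obtain ⟨N, hN⟩ := exists_nat_ge (max (X.period O) (X.period O'))
    refine mem_iInter.1 hX (j, j', c, N) hval hval' ⟨hgood, hgood', _, _, _, _,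
      hloop _ N (fun t ht => hcore' _ ht (mem_range_self t)) ((le_max_left _ _).trans hN),
      hloop' _ N (fun t ht => hcore _ ht (mem_range_self t)) ((le_max_right _ _).trans hN), ?_⟩
    rw [hc, div_mul_cancel₀ _ hpos'.ne']

end CrVectorField

end

theorem lemma1 (d r : ℕ) (hd : 3 ≤ d) (hr : 1 ≤ r)
    (M : Type*) [TopologicalSpace M] [T2Space M] [CompactSpace M]
    [ChartedSpace (EuclideanSpace ℝ (Fin d)) M] [IsManifold (𝓡 d) ∞ M] :
    ∃ R₁ ∈ residual (CrVectorField d r M), ∀ X ∈ R₁, ∀ O O' : Set M,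
      X.IsClosedOrbit O → X.IsClosedOrbit O' → O ≠ O' →
        Irrational (X.period O / X.period O') :=
  CrVectorField.exists_residual_irrational_period hr
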